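/- All topological spaces and topological vector spaces are assumed Hausdorff; topological vector spaces are real and need not be locally convex. **Setting.** Let $M$ be a topological space, $(A,\leq)$ a directed set, and $(M_\alpha)_{\alpha\in A}$ a family of subsets of $M$ with $M_\alpha\subseteq M_\beta$ for $\alpha\leq\beta$, each $M_\alpha$ being endowed with a topology (not necessarily the subspace topology) such that all inclusion maps $\lambda_\alpha\colon M_\alpha\to M$ and $\lambda_{\beta,\alpha}\colon M_\alpha\to M_\beta$ ($\alpha\leq\beta$) are continuous. Assume that $M_\infty:=\bigcup_{\alpha\in A}M_\alpha$ is dense in $M$. For $p\in M_\infty$, let $A_p:=\{\alpha\in A\colon p\in M_\alpha\}$. **Well-filled charts.** For a subset $Y$ of a vector space, let $\operatorname{conv}_2(Y):=\{tx+(1-t)y\colon x,y\in Y,\ t\in[0,1]\}$. A homeomorphism $\phi\colon U\to V\subseteq E$ from an open set $U\subseteq M$ onto an arbitrary subset $V$ of a topological vector space $E$ is a *well-filled chart* of $M$ if there exist $\alpha_0\in A$, homeomorphisms $\phi_\alpha\colon U_\alpha\to V_\alpha\subseteq E_\alpha$ from open subsets $U_\alpha\subseteq M_\alpha$ onto subsets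 $V_\alpha$ of topological vector spaces $E_\alpha$ (for $\alpha\geq\alpha_0$) and continuous linear maps $\Lambda_\alpha\colon E_\alpha\to E$, $\Lambda_{\beta,\alpha}\colon E_\alpha\to E_\beta$ (for $\beta\geq\alpha\geq\alpha_0$) such that: * (a) $U_\alpha\subseteq U$ and $\phi|_{U_\alpha}=\Lambda_\alpha\circ\phi_\alpha$ for all $\alpha\geq\alpha_0$; * (b) $U_\alpha\subseteq U_\beta$ and $\phi_\beta|_{U_\alpha}=\Lambda_{\beta,\alpha}\circ\phi_\alpha$ for all $\beta\geq\alpha\geq\alpha_0$; * (d) $\bigcup_{\alpha\geq\alpha_0}U_\alpha=U\cap M_\infty$; * (e) there is a non-empty relatively open set $V^{(2)}\subseteq V$ such that $\operatorname{conv}_2(V^{(2)})\subseteq V$ and $\operatorname{conv}_2(V^{(2)}\cap V_\infty)\subseteq V_\infty$, where $V_\infty:=\bigcup_{\alpha\geq\alpha_0}\Lambda_\alpha(V_\alpha)$; * (f) for each $\alpha\geq\alpha_0$ and each compact set $K\subseteq V_\alpha$ with $\Lambda_\alpha(K)\subseteq V^{(2)}$, there exists $\beta\geq\alpha$ such that $\operatorname{conv}_2(\Lambda_{\beta,\alpha}(K))\subseteq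 V_\beta$. (If all $\Lambda_\alpha$ and $\Lambda_{\beta,\alpha}$ are inclusion maps $E_\alpha\subseteq E_\beta\subseteq E$, they can be omitted in (e) and (f).) The set $\phi^{-1}(V^{(2)})$ is then called a *core* of $\phi$. We say that $M$ *admits well-filled charts* if $M$ is covered by cores of well-filled charts. **Theorem.** If $M$ admits well-filled charts, then $$\pi_k(M,p)=\varinjlim_{\alpha\in A_p}\pi_k(M_\alpha,p)\qquad\text{for all }k\in\mathbb N_0\text{ and }p\in M_\infty,$$ as sets for every $k\geq 0$ and as groups for $k\geq 1$; that is, the canonical map from the direct limit, induced by the maps $(\lambda_\alpha)_*\colon\pi_k(M_\alpha,p)\to\pi_k(M,p)$, is a bijection, and it is an isomorphism of groups if $k\geq1$. If, moreover, $M$ and all $M_\alpha$ are topological groups and all $\lambda_\alpha$ are homomorphisms, then the canonical map $\varinjlim_{\alpha\in A_1}\pi_0(M_\alpha,1)\to\pi_0(M,1)$ is an isomorphism of groups, where $\pi_0(G,1)$ carries the group structure $[x][y]=[xy]$. -/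

import Mathlib

open Set Topology

universe u v w

/-! ### Functoriality of homotopy groups -/

section HomotopyFunctoriality

variable {X Y Z : Type u} [TopologicalSpace X] [TopologicalSpace Y] [TopologicalSpace Z]

/-- Post-composition of a generalized loop with a base point preserving continuous map. -/
def genLoopMap (N : Type) (f : C(X, Y)) {x : X} {y : Y} (h : f x = y) (γ : GenLoop N X x) :
    GenLoop N Y y :=
  ⟨f.comp γ.1, fun t ht => by
    change f (γ.1 t) = y
    rw [γ.2 t ht, h]⟩

/-- The map `f_* : π_N(X, x) → π_N(Y, y)`, `[γ] ↦ [f ∘ γ]`. -/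
def homotopyGroupMap (N : Type) (f : C(X, Y)) {x : X} {y : Y} (h : f x = y) :
    HomotopyGroup N X x → HomotopyGroup N Y y :=
  Quotient.map (genLoopMap N f h) fun _ _ H =>
    ContinuousMap.HomotopicRel.comp_continuousMap H f

theorem homotopyGroupMap_mk (N : Type) (f : C(X, Y)) {x : X} {y : Y} (h : f x = y)
    (γ : GenLoop N X x) :
    homotopyGroupMap N f h (Quotient.mk _ γ) = Quotient.mk _ (genLoopMap N f h γ) := rfl

theorem homotopyGroupMap_self (N : Type) (f : C(X, X)) {x : X} (h : f x = x)
    (hf : ∀ z, f z = z) (c : HomotopyGroup N X x) : homotopyGroupMap N f h c = c := by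
  induction c using Quotient.inductionOn with
  | h γ =>
    rw [homotopyGroupMap_mk]
    congr 1
    ext t
    exact hf _

theorem homotopyGroupMap_comp (N : Type) (f : C(X, Y)) (g : C(Y, Z)) (k : C(X, Z))
    {x : X} {y : Y} {z : Z} (hf : f x = y) (hg : g y = z) (hk : k x = z)
    (hc : ∀ a, g (f a) = k a) (c : HomotopyGroup N X x) :
    homotopyGroupMap N g hg (homotopyGroupMap N f hf c) = homotopyGroupMap N k hk c := by
  induction c using Quotient.inductionOn with
  | h γ =>
    simp only [homotopyGroupMap_mk]
    congr 1
    ext t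
    exact hc _

/-- For `N ≠ ∅`, the map `f_*` as a group homomorphism. -/
noncomputable def homotopyGroupHom (N : Type) [DecidableEq N] [Nonempty N] (f : C(X, Y)) {x : X} {y : Y}
    (h : f x = y) : HomotopyGroup N X x →* HomotopyGroup N Y y :=
  MonoidHom.mk' (homotopyGroupMap N f h) fun a b => by
    induction a using Quotient.inductionOn with
    | h p =>
    induction b using Quotient.inductionOn with
    | h q =>
    have i : N := Classical.arbitrary N
    have e1 := HomotopyGroup.mul_spec (i := i) (p := p) (q := q)
    have e2 := HomotopyGroup.mul_spec (i := i) (p := genLoopMap N f h p) (q := genLoopMap N f h q)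
    refine (congrArg (homotopyGroupMap N f h) e1).trans (Eq.trans ?_ e2.symm)
    refine (homotopyGroupMap_mk N f h _).trans ?_
    refine congrArg _ ?_
    ext t
    change f (GenLoop.transAt i q p t) = GenLoop.transAt i (genLoopMap N f h q) (genLoopMap N f h p) t
    simp only [GenLoop.transAt, GenLoop.coe_copy]
    split_ifs <;> rfl

end HomotopyFunctoriality

/-! ### The group `π₀(G) = G / G₍₁₎` of a topological group -/

section PiZeroGroup

/-- The relation of being joined by a path is a congruence on a topological group. -/
def joinedCon (G : Type u) [Group G] [TopologicalSpace G] [IsTopologicalGroup G] : Con G where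
  r := Joined
  iseqv := (pathSetoid G).iseqv
  mul' := fun h₁ h₂ => h₁.mul h₂

/-- The group structure `[x][y] = [xy]` on the set of path components of a topological group. -/
instance zerothHomotopyGroup (G : Type u) [Group G] [TopologicalSpace G] [IsTopologicalGroup G] :
    Group (ZerothHomotopy G) :=
  inferInstanceAs (Group (joinedCon G).Quotient)

/-- The group structure on `π₀(G, x)`, via the identification with the set of path components. -/
noncomputable instance piZeroGroup (G : Type u) [Group G] [TopologicalSpace G]
    [IsTopologicalGroup G] (x : G) : Group (HomotopyGroup (Fin 0) G x) :=
  (HomotopyGroup.pi0EquivZerothHomotopy (X := G) (x := x)).group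

/-- A continuous homomorphism `f` of topological groups induces a homomorphism on `π₀`. -/
noncomputable def piZeroHom {G H : Type u} [Group G] [TopologicalSpace G] [IsTopologicalGroup G]
    [Group H] [TopologicalSpace H] [IsTopologicalGroup H] (f : C(G, H))
    (hf : ∀ a b, f (a * b) = f a * f b) {x : G} {y : H} (h : f x = y) :
    HomotopyGroup (Fin 0) G x →* HomotopyGroup (Fin 0) H y :=
  MonoidHom.mk' (homotopyGroupMap (Fin 0) f h) fun a b => by
    have key : ∀ c : HomotopyGroup (Fin 0) G x,
        HomotopyGroup.pi0EquivZerothHomotopy (homotopyGroupMap (Fin 0) f h c) =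
          Quotient.map (sa := pathSetoid G) (sb := pathSetoid H) f
            (fun _ _ (j : Joined _ _) => j.map f.continuous)
            (HomotopyGroup.pi0EquivZerothHomotopy c) := by
      intro c
      induction c using Quotient.inductionOn with
      | h γ => rfl
    have mulG : ∀ c d : HomotopyGroup (Fin 0) G x,
        HomotopyGroup.pi0EquivZerothHomotopy (c * d) =
          HomotopyGroup.pi0EquivZerothHomotopy c * HomotopyGroup.pi0EquivZerothHomotopy d :=
      fun c d => Equiv.apply_symm_apply _ _
    have mulH : ∀ c d : HomotopyGroup (Fin 0) H y,
        HomotopyGroup.pi0EquivZerothHomotopy (c * d) =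
          HomotopyGroup.pi0EquivZerothHomotopy c * HomotopyGroup.pi0EquivZerothHomotopy d :=
      fun c d => Equiv.apply_symm_apply _ _
    apply HomotopyGroup.pi0EquivZerothHomotopy.injective
    rw [key, mulG, mulH, key, key]
    generalize HomotopyGroup.pi0EquivZerothHomotopy a = a'
    generalize HomotopyGroup.pi0EquivZerothHomotopy b = b'
    obtain ⟨a', rfl⟩ := ZerothHomotopy.mk_surjective a'
    obtain ⟨b', rfl⟩ := ZerothHomotopy.mk_surjective b'
    exact congrArg ZerothHomotopy.mk (hf a' b')

end PiZeroGroup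

/-! ### Directed families of topological spaces -/

/-- A directed family `(M_α)_{α ∈ A}` of subsets of `M`, each with a topology of its own (which
need not be the subspace topology), such that the inclusion maps `M_α → M` and `M_α → M_β` for
`α ≤ β` are continuous. -/
structure DirectedFamily (A : Type v) [Preorder A] (M : Type u) [TopologicalSpace M] where
  carrier : A → Set M
  top : ∀ α, TopologicalSpace (carrier α)
  mono : ∀ ⦃α β⦄, α ≤ β → carrier α ⊆ carrier β
  continuous_val : ∀ α, @Continuous (carrier α) M (top α) _ Subtype.val
  continuous_inclusion : ∀ ⦃α β⦄ (h : α ≤ β),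
    @Continuous (carrier α) (carrier β) (top α) (top β) (Set.inclusion (mono h))

namespace DirectedFamily

variable {A : Type v} [Preorder A] {M : Type u} [TopologicalSpace M] (F : DirectedFamily A M)

/-- The topological space `M_α` (a type of its own, so that it does not get the subspace
topology). -/
def Space (α : A) : Type u := F.carrier α

instance (α : A) : TopologicalSpace (F.Space α) := F.top α

/-- The inclusion map `λ_α : M_α → M`. -/
def incl (α : A) : C(F.Space α, M) where
  toFun x := Subtype.val (p := (· ∈ F.carrier α)) x
  continuous_toFun := F.continuous_val α

/-- The inclusion map `λ_{β,α} : M_α → M_β` for `α ≤ β`. -/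
def trans {α β : A} (h : α ≤ β) : C(F.Space α, F.Space β) where
  toFun x := Set.inclusion (F.mono h) x
  continuous_toFun := F.continuous_inclusion h

/-- The union `M_∞` of all `M_α`. -/
def union : Set M := ⋃ α, F.carrier α

/-- The index set `A_p = {α ∈ A : p ∈ M_α}`. -/
abbrev Above (p : M) : Type v := {α : A // p ∈ F.carrier α}

instance [IsDirectedOrder A] (p : M) : IsDirectedOrder (F.Above p) :=
  ⟨fun α β => by
    obtain ⟨γ, h₁, h₂⟩ := exists_ge_ge α.1 β.1
    exact ⟨⟨γ, F.mono h₁ α.2⟩, h₁, h₂⟩⟩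

/-- The point `p` as an element of `M_α`, for `α ∈ A_p`. -/
def pt {p : M} (α : F.Above p) : F.Space α.1 := ⟨p, α.2⟩

/-! ### The direct systems of homotopy groups -/

/-- The maps `(λ_{β,α})_* : π_k(M_α, p) → π_k(M_β, p)`. -/
def piMap (k : ℕ) (p : M) (α β : F.Above p) (h : α ≤ β) :
    TypeCat.Fun (HomotopyGroup.Pi k (F.Space α.1) (F.pt α))
      (HomotopyGroup.Pi k (F.Space β.1) (F.pt β)) :=
  ⟨homotopyGroupMap (Fin k) (F.trans (α := α.1) (β := β.1) h) rfl⟩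

instance (k : ℕ) (p : M) :
    DirectedSystem (fun α : F.Above p => HomotopyGroup.Pi k (F.Space α.1) (F.pt α))
      (fun _ _ h => F.piMap k p _ _ h) where
  map_self _ c := homotopyGroupMap_self _ _ _ (fun _ => rfl) c
  map_map _ _ _ _ _ c := homotopyGroupMap_comp _ _ _ _ _ _ _ (fun _ => rfl) c

/-- The map `(λ_α)_* : π_k(M_α, p) → π_k(M, p)`. -/
def piIncl (k : ℕ) {p : M} (α : F.Above p) :
    HomotopyGroup.Pi k (F.Space α.1) (F.pt α) → HomotopyGroup.Pi k M p :=
  homotopyGroupMap (Fin k) (F.incl α.1) rfl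

/-- The homomorphisms `(λ_{β,α})_* : π_{k+1}(M_α, p) → π_{k+1}(M_β, p)`. -/
noncomputable def piHom (k : ℕ) (p : M) (α β : F.Above p) (h : α ≤ β) :
    HomotopyGroup.Pi (k + 1) (F.Space α.1) (F.pt α) →*
      HomotopyGroup.Pi (k + 1) (F.Space β.1) (F.pt β) :=
  homotopyGroupHom (Fin (k + 1)) (F.trans (α := α.1) (β := β.1) h) rfl

instance (k : ℕ) (p : M) :
    DirectedSystem (fun α : F.Above p => HomotopyGroup.Pi (k + 1) (F.Space α.1) (F.pt α))
      (fun _ _ h => F.piHom k p _ _ h) where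
  map_self _ c := homotopyGroupMap_self _ _ _ (fun _ => rfl) c
  map_map _ _ _ _ _ c := homotopyGroupMap_comp _ _ _ _ _ _ _ (fun _ => rfl) c

section Groups

variable [Group M] [∀ α, Group (F.Space α)]

/-- All inclusion maps `M_α → M` are homomorphisms of groups (hence so are `M_α → M_β`). -/
def InclusionsAreHoms : Prop :=
  ∀ α (x y : F.Space α), F.incl α (x * y) = F.incl α x * F.incl α y

variable {F} in
theorem InclusionsAreHoms.trans_mul (hF : F.InclusionsAreHoms) {α β : A} (h : α ≤ β)
    (x y : F.Space α) : F.trans h (x * y) = F.trans h x * F.trans h y :=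
  Subtype.val_injective (p := (· ∈ F.carrier β)) <|
    (hF α x y).trans (hF β (F.trans h x) (F.trans h y)).symm

variable [IsTopologicalGroup M] [∀ α, IsTopologicalGroup (F.Space α)]

variable {F} in
/-- The homomorphisms `(λ_{β,α})_* : π₀(M_α, p) → π₀(M_β, p)` for topological groups. -/
noncomputable def InclusionsAreHoms.piZero (hF : F.InclusionsAreHoms) (p : M)
    (α β : F.Above p) (h : α ≤ β) :
    HomotopyGroup.Pi 0 (F.Space α.1) (F.pt α) →* HomotopyGroup.Pi 0 (F.Space β.1) (F.pt β) :=
  piZeroHom (F.trans (α := α.1) (β := β.1) h) (hF.trans_mul h) rfl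

instance (hF : F.InclusionsAreHoms) (p : M) :
    DirectedSystem (fun α : F.Above p => HomotopyGroup.Pi 0 (F.Space α.1) (F.pt α))
      (fun _ _ h => hF.piZero p _ _ h) where
  map_self _ c := homotopyGroupMap_self _ _ _ (fun _ => rfl) c
  map_map _ _ _ _ _ c := homotopyGroupMap_comp _ _ _ _ _ _ _ (fun _ => rfl) c

end Groups

end DirectedFamily

/-! ### Well-filled charts -/

/-- A Hausdorff real topological vector space (not necessarily locally convex). -/
structure HausdorffTVS : Type (w + 1) where
  carrier : Type w
  [addCommGroup : AddCommGroup carrier]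
  [module : Module ℝ carrier]
  [topologicalSpace : TopologicalSpace carrier]
  [isTopologicalAddGroup : IsTopologicalAddGroup carrier]
  [continuousSMul : ContinuousSMul ℝ carrier]
  [t2Space : T2Space carrier]

instance : CoeSort HausdorffTVS.{w} (Type w) := ⟨HausdorffTVS.carrier⟩

attribute [instance] HausdorffTVS.addCommGroup HausdorffTVS.module HausdorffTVS.topologicalSpace
  HausdorffTVS.isTopologicalAddGroup HausdorffTVS.continuousSMul HausdorffTVS.t2Space

/-- `conv₂(Y) = {t x + (1 - t) y : x, y ∈ Y, t ∈ [0,1]}`. -/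
def conv2 {E : Type w} [AddCommGroup E] [Module ℝ E] (Y : Set E) : Set E :=
  {z | ∃ x ∈ Y, ∃ y ∈ Y, ∃ t ∈ Set.Icc (0 : ℝ) 1, z = t • x + (1 - t) • y}

/-- A well-filled chart `φ : U → V ⊆ E` of `M`, together with a choice of the auxiliary data
`α₀`, `φ_α : U_α → V_α ⊆ E_α`, `λ_α : E_α → E`, `λ_{β,α} : E_α → E_β` and of the set `V⁽²⁾`
defining a core. Vectors of `E_α` are compared with vectors of `E_β` and `E` by means of the maps
`λ_{β,α}` and `λ_α`, which is the identification `E_α ⊆ E_β ⊆ E` if these are inclusion maps. -/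
structure WellFilledChart {A : Type v} [Preorder A] {M : Type u} [TopologicalSpace M]
    (F : DirectedFamily A M) (E : HausdorffTVS.{w}) where
  U : Set M
  isOpen_U : IsOpen U
  V : Set E
  φ : U ≃ₜ V
  α₀ : A
  Eα : Set.Ici α₀ → HausdorffTVS.{w}
  Uα : ∀ α : Set.Ici α₀, Set (F.Space α.1)
  isOpen_Uα : ∀ α, IsOpen (Uα α)
  Vα : ∀ α, Set (Eα α)
  φα : ∀ α, Uα α ≃ₜ Vα α
  lam : ∀ α, Eα α →L[ℝ] E
  lamTrans : ∀ ⦃α β : Set.Ici α₀⦄, α ≤ β → Eα α →L[ℝ] Eα β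
  /-- (a): `U_α ⊆ U` and `φ = λ_α ∘ φ_α` on `U_α` -/
  Uα_subset : ∀ α (x : Uα α), F.incl α.1 x.1 ∈ U
  φ_eq : ∀ α (x : Uα α), (φ ⟨F.incl α.1 x.1, Uα_subset α x⟩ : E) = lam α (φα α x)
  /-- (b): `U_α ⊆ U_β` and `φ_β = λ_{β,α} ∘ φ_α` on `U_α`, for `α ≤ β` -/
  Uα_mono : ∀ ⦃α β : Set.Ici α₀⦄ (h : α ≤ β) (x : Uα α), F.trans h x.1 ∈ Uα β
  φα_eq : ∀ ⦃α β : Set.Ici α₀⦄ (h : α ≤ β) (x : Uα α),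
    (φα β ⟨F.trans h x.1, Uα_mono h x⟩ : Eα β) = lamTrans h (φα α x)
  /-- (d): `⋃ U_α = U ∩ M_∞` -/
  iUnion_Uα : ⋃ α, F.incl α.1 '' Uα α = U ∩ F.union
  /-- (e): the non-empty relatively open set `V⁽²⁾ ⊆ V`, with `conv₂(V⁽²⁾) ⊆ V` and
  `conv₂(V⁽²⁾ ∩ V_∞) ⊆ V_∞`, where `V_∞ = ⋃ V_α` -/
  V2 : Set E
  V2_nonempty : V2.Nonempty
  V2_relOpen : ∃ O : Set E, IsOpen O ∧ V2 = V ∩ O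
  conv2_V2 : conv2 V2 ⊆ V
  conv2_V2_inter : conv2 (V2 ∩ ⋃ α, lam α '' Vα α) ⊆ ⋃ α, lam α '' Vα α
  /-- (f): for every compact set `K ⊆ V⁽²⁾ ∩ V_α`, there is `β ≥ α` with `conv₂(K) ⊆ V_β` -/
  conv2_compact : ∀ α (K : Set (Eα α)), IsCompact K → K ⊆ Vα α → lam α '' K ⊆ V2 →
    ∃ β, ∃ h : α ≤ β, conv2 (lamTrans h '' K) ⊆ Vα β

/-- The core `U⁽²⁾ = φ⁻¹(V⁽²⁾)`. -/
def WellFilledChart.core {A : Type v} [Preorder A] {M : Type u} [TopologicalSpace M]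
    {F : DirectedFamily A M} {E : HausdorffTVS.{w}} (c : WellFilledChart F E) : Set M :=
  {x | ∃ h : x ∈ c.U, (c.φ ⟨x, h⟩ : E) ∈ c.V2}

/-- `M` admits well-filled charts if it is covered by cores of well-filled charts. -/
def AdmitsWellFilledCharts {A : Type v} [Preorder A] {M : Type u} [TopologicalSpace M]
    (F : DirectedFamily A M) : Prop :=
  ∀ x : M, ∃ (E : HausdorffTVS.{w}) (c : WellFilledChart F E), x ∈ c.core

/-! Everything follows from one deformation principle, `DirectedFamily.exists_deforms_cube`, about
maps from a cube to `M` whose restriction to the boundary is a continuous map to one `M_α`. Applied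
to a loop, which is constant on the boundary, it shows that every class comes from some `M_β`.
Applied to a homotopy in `M` between two loops in `M_α`, which is a map on a cube with one more
coordinate, it shows that the loops become homotopic in some `M_β`. These are surjectivity and
injectivity of the map from the direct limit; the rest is formal.

To deform a map `f`, the cube is cut into small cubes and the homotopy is built cell by cell, in
order of dimension. On the boundary of a cell the end map already takes values in some `M_α`; it is
extended by coning it off in a chart, with apex in the dense set `M_∞`. A cone consists of segments,
so (e) keeps it inside the chart, and (f), applied to the compact set formed by the apex and the
image of the base, makes it a continuous map to a single `M_β` (`exists_cone_extension`). The
cylinder over a cell is itself a cone over its boundary, so a second cone fills in the homotopy from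
`f` to the new map (`exists_deforms_extension`). For a vertex the base is empty and the cone is just
a nearby point of `M_∞`.

Each extension needs a smaller neighbourhood of the graph of `f` than the one in which it ends. As
there are only finitely many dimensions, these neighbourhoods can be chosen from the top dimension
downwards, before the mesh of the grid is fixed (`exists_nhds_graph`). -/

/-! ### Cones in topological vector spaces -/

/-- Cone coordinates on a pair of sets `B ⊆ D`: the set `D` is a cone over `B`, where `r` is the
distance from the apex (`r = 1` on the base `B`) and `s` is the projection to the base. -/
structure ConePair {X : Type*} [TopologicalSpace X] (D B : Set X) where
  r : X → ℝ
  s : X → X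
  base_subset : B ⊆ D
  isCompact_base : IsCompact B
  continuousOn_r : ContinuousOn r D
  r_mem : ∀ x ∈ D, r x ∈ Icc (0 : ℝ) 1
  s_mem : ∀ x ∈ D, r x ≠ 0 → s x ∈ B
  continuousOn_s : ContinuousOn s (D ∩ {x | r x ≠ 0})
  r_eq : ∀ x ∈ B, r x = 1
  s_eq : ∀ x ∈ B, s x = x

namespace ConePair

variable {X : Type*} [TopologicalSpace X] {D B : Set X} (P : ConePair D B)
  {E : Type*} [AddCommGroup E] [Module ℝ E]

/-- The map `D → E` which is linear on the rays of the cone `D`, equals `v` on the base and `c` at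
the apex. -/
def cone (v : X → E) (c : E) (x : X) : E := P.r x • v (P.s x) + (1 - P.r x) • c

theorem cone_eq (v : X → E) (c : E) {x : X} (hx : x ∈ B) : P.cone v c x = v x := by
  simp [cone, P.r_eq x hx, P.s_eq x hx]

theorem exists_cone_eq (v : X → E) (c : E) {x : X} (hx : x ∈ D) :
    ∃ a ∈ insert c (v '' B), P.cone v c x = P.r x • a + (1 - P.r x) • c := by
  by_cases h : P.r x = 0
  · exact ⟨c, mem_insert _ _, by simp [cone, h]⟩
  · exact ⟨v (P.s x), mem_insert_of_mem _ (mem_image_of_mem _ (P.s_mem x hx h)), rfl⟩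

theorem cone_mem_conv2 {E : Type w} [AddCommGroup E] [Module ℝ E] (v : X → E) (c : E) {x : X}
    (hx : x ∈ D) : P.cone v c x ∈ conv2 (insert c (v '' B)) := by
  obtain ⟨a, ha, h⟩ := P.exists_cone_eq v c hx
  exact ⟨a, ha, c, mem_insert _ _, P.r x, P.r_mem x hx, h⟩

/-- Only the apex is delicate, as `s` has no limit there. But `v` is bounded on the compact base, so
`r • v (s x)` tends to `0` with `r`; this needs no local convexity. -/
theorem continuousOn_cone [TopologicalSpace E] [IsTopologicalAddGroup E] [ContinuousSMul ℝ E]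
    {v : X → E} (hv : ContinuousOn v B) (c : E) : ContinuousOn (P.cone v c) D := by
  refine ContinuousOn.add ?_ ((continuousOn_const.sub P.continuousOn_r).smul continuousOn_const)
  intro x hx
  by_cases h : P.r x = 0
  -- The vector `0` is adjoined to cover the points with `r = 0`, where `s` may leave `B`.
  · have hb : Bornology.IsVonNBounded ℝ (insert 0 (v '' B)) :=
      ((P.isCompact_base.image_of_continuousOn hv).insert 0).isVonNBounded ℝ
    have hr : Filter.Tendsto P.r (𝓝[D] x) (𝓝 0) := h ▸ P.continuousOn_r x hx
    have key := hb.smul_tendsto_zero (x := fun y => if P.r y = 0 then (0 : E) else v (P.s y))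
      (l := 𝓝[D] x) (ε := P.r) ?_ hr
    · unfold ContinuousWithinAt
      simp only [h, zero_smul]
      refine key.congr fun y => ?_
      by_cases hy : P.r y = 0 <;> simp [hy]
    · filter_upwards [self_mem_nhdsWithin] with y hy
      by_cases h' : P.r y = 0
      · simp [h']
      · simpa [h'] using Or.inr ⟨_, P.s_mem y hy h', rfl⟩
  · have h1 : ContinuousWithinAt (fun x => P.r x • v (P.s x)) (D ∩ {x | P.r x ≠ 0}) x :=
      ((P.continuousOn_r.mono inter_subset_left).smul
        (hv.comp P.continuousOn_s fun y hy => P.s_mem y hy.1 hy.2)) x ⟨hx, h⟩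
    refine h1.mono_of_mem_nhdsWithin ?_
    exact Filter.inter_mem self_mem_nhdsWithin (P.continuousOn_r x hx (isOpen_ne.mem_nhds h))

end ConePair

/-! ### Maps which factor through one of the spaces `M_α` -/

namespace DirectedFamily

variable {A : Type v} [Preorder A] {M : Type u} [TopologicalSpace M] (F : DirectedFamily A M)

theorem incl_injective (α : A) : Function.Injective (F.incl α) :=
  fun _ _ h => Subtype.val_injective (p := (· ∈ F.carrier α)) h

theorem incl_trans {α β : A} (h : α ≤ β) (x : F.Space α) : F.incl β (F.trans h x) = F.incl α x :=
  rfl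

/-- On the set `S`, the map `f` takes its values in `M_α` and is continuous as a map to `M_α`. -/
def LiftsOn {X : Type*} [TopologicalSpace X] (α : A) (S : Set X) (f : X → M) : Prop :=
  ∃ g : X → F.Space α, ContinuousOn g S ∧ ∀ x ∈ S, F.incl α (g x) = f x

namespace LiftsOn

variable {F} {X : Type*} [TopologicalSpace X] {α β : A} {S T : Set X}
  {f f' : X → M}

theorem mono (h : F.LiftsOn α T f) (hST : S ⊆ T) : F.LiftsOn α S f :=
  let ⟨g, hg, hgf⟩ := h
  ⟨g, hg.mono hST, fun x hx => hgf x (hST hx)⟩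

theorem congr (h : F.LiftsOn α S f) (hf : EqOn f' f S) : F.LiftsOn α S f' :=
  let ⟨g, hg, hgf⟩ := h
  ⟨g, hg, fun x hx => (hgf x hx).trans (hf hx).symm⟩

theorem of_le (h : F.LiftsOn α S f) (hαβ : α ≤ β) : F.LiftsOn β S f :=
  let ⟨g, hg, hgf⟩ := h
  ⟨fun x => F.trans hαβ (g x), (F.trans hαβ).continuous.comp_continuousOn hg, hgf⟩

theorem continuousOn (h : F.LiftsOn α S f) : ContinuousOn f S :=
  let ⟨_, hg, hgf⟩ := h
  ((F.incl α).continuous.comp_continuousOn hg).congr fun _ hx => (hgf _ hx).symm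

/-- The two lifts agree on `S ∩ T` without further assumption because `λ_α` is injective, so they
can be glued along closed sets. -/
theorem union (hS : F.LiftsOn α S f) (hT : F.LiftsOn α T f) (cS : IsClosed S) (cT : IsClosed T) :
    F.LiftsOn α (S ∪ T) f := by
  classical
  obtain ⟨g, hg, hgf⟩ := hS
  obtain ⟨g', hg', hgf'⟩ := hT
  have e : EqOn (S.piecewise g g') g' T := by
    intro x hx
    by_cases h : x ∈ S
    · rw [piecewise_eq_of_mem _ _ _ h]
      exact F.incl_injective α ((hgf x h).trans (hgf' x hx).symm)
    · rw [piecewise_eq_of_notMem _ _ _ h]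
  refine ⟨S.piecewise g g', (hg.congr (piecewise_eqOn _ _ _)).union_of_isClosed (hg'.congr e) cS cT,
    fun x hx => ?_⟩
  by_cases h : x ∈ S
  · rw [piecewise_eq_of_mem _ _ _ h, hgf x h]
  · rw [piecewise_eq_of_notMem _ _ _ h, hgf' x (hx.resolve_left h)]

end LiftsOn

end DirectedFamily

/-- A homeomorphism between subsets, as a pair of maps between the ambient spaces. -/
theorem Homeomorph.exists_extend {X Y : Type*} [TopologicalSpace X] [TopologicalSpace Y]
    [Nonempty X] [Nonempty Y] {S : Set X} {T : Set Y} (e : S ≃ₜ T) :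
    ∃ (f : X → Y) (g : Y → X), ContinuousOn f S ∧ ContinuousOn g T ∧ (∀ x : S, f x = e x) ∧
      ∀ y : T, g y = e.symm y := by
  classical
  let f : X → Y := fun x => if h : x ∈ S then (e ⟨x, h⟩ : Y) else Classical.arbitrary Y
  let g : Y → X := fun y => if h : y ∈ T then (e.symm ⟨y, h⟩ : X) else Classical.arbitrary X
  have hf : ∀ x : S, f x = e x := fun x => dif_pos x.2
  have hg : ∀ y : T, g y = e.symm y := fun x => dif_pos x.2
  refine ⟨f, g, ?_, ?_, hf, hg⟩
  · rw [continuousOn_iff_continuous_domRestrict]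
    exact (continuous_subtype_val.comp e.continuous).congr fun x => (hf x).symm
  · rw [continuousOn_iff_continuous_domRestrict]
    exact (continuous_subtype_val.comp e.symm.continuous).congr fun x => (hg x).symm

/-- Points close to `q` can be joined by segments which stay close to `q`. -/
theorem eventually_segment_mem {E : Type*} [AddCommGroup E] [Module ℝ E] [TopologicalSpace E]
    [IsTopologicalAddGroup E] [ContinuousSMul ℝ E] {q : E} {s : Set E} (hs : s ∈ 𝓝 q) :
    ∃ O : Set E, IsOpen O ∧ q ∈ O ∧
      ∀ x ∈ O, ∀ y ∈ O, ∀ t ∈ Icc (0 : ℝ) 1, t • x + (1 - t) • y ∈ s := by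
  have h : ∀ᶠ z : E × E in 𝓝 (q, q), ∀ t ∈ Icc (0 : ℝ) 1, t • z.1 + (1 - t) • z.2 ∈ s := by
    -- In place of a convex neighbourhood: the constant segment at `q` lies in `s`, and compactness
    -- of `[0,1]` makes the condition open in the end points.
    refine isCompact_Icc.eventually_forall_of_forall_eventually fun t _ => ?_
    have hc : Continuous fun z : (E × E) × ℝ => z.2 • z.1.1 + (1 - z.2) • z.1.2 := by fun_prop
    refine hc.continuousAt.eventually_mem ?_
    simpa [← add_smul] using hs
  rw [nhds_prod_eq, Filter.eventually_prod_self_iff'] at h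
  obtain ⟨O', hO', h⟩ := h
  obtain ⟨O, hO, hOo, hq⟩ := mem_nhds_iff.1 hO'
  exact ⟨O, hOo, hq, fun x hx y hy => h x (hO hx) y (hO hy)⟩

/-! ### Segments and cones inside a well-filled chart. -/

namespace WellFilledChart

variable {A : Type v} [Preorder A] {M : Type u} [TopologicalSpace M]
  {F : DirectedFamily A M} {E : HausdorffTVS.{w}} (c : WellFilledChart F E)

theorem exists_mem_Uα {x : M} (hx : x ∈ c.U) (hx' : x ∈ F.union) :
    ∃ α, ∃ y ∈ c.Uα α, F.incl α.1 y = x := by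
  have : x ∈ ⋃ α, F.incl α.1 '' c.Uα α := c.iUnion_Uα ▸ ⟨hx, hx'⟩
  simpa using this

variable [IsDirectedOrder A]

theorem exists_trans_mem_Uα {α : A} (y : F.Space α) (hy : F.incl α y ∈ c.U) :
    ∃ (β : Ici c.α₀) (h : α ≤ β.1), F.trans h y ∈ c.Uα β := by
  obtain ⟨γ, z, hz, e⟩ := c.exists_mem_Uα hy (mem_iUnion.2 ⟨α, y.2⟩)
  obtain ⟨δ, h₁, h₂⟩ := exists_ge_ge α γ.1
  refine ⟨⟨δ, γ.2.trans h₂⟩, h₁, ?_⟩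
  have := c.Uα_mono (β := ⟨δ, γ.2.trans h₂⟩) h₂ ⟨z, hz⟩
  convert this using 1
  exact F.incl_injective δ e.symm

/-- A compact subset of `M_α` which is contained in `U` is contained in some `U_β`. -/
theorem exists_image_subset_Uα {α : A} {K : Set (F.Space α)} (hK : IsCompact K)
    (hKU : ∀ y ∈ K, F.incl α y ∈ c.U) :
    ∃ (β : Ici c.α₀) (h : α ≤ β.1), ∀ y ∈ K, F.trans h y ∈ c.Uα β := by
  obtain ⟨δ, h₁, h₂⟩ := exists_ge_ge α c.α₀
  have : Nonempty {β : Ici c.α₀ // α ≤ β.1} := ⟨⟨⟨δ, h₂⟩, h₁⟩⟩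
  -- By (d) and (b), the preimages of the sets `U_β` form a directed open cover of `K`, so one of
  -- them suffices.
  obtain ⟨β, hβ⟩ := hK.elim_directed_cover
    (fun β : {β : Ici c.α₀ // α ≤ β.1} => F.trans β.2 ⁻¹' c.Uα β.1)
    (fun β => (c.isOpen_Uα β.1).preimage (F.trans β.2).continuous)
    (fun y hy => by
      obtain ⟨β, h, hβ⟩ := c.exists_trans_mem_Uα y (hKU y hy)
      exact mem_iUnion.2 ⟨⟨β, h⟩, hβ⟩)
    (fun β β' => by
      obtain ⟨γ, hγ, hγ'⟩ := exists_ge_ge β.1.1 β'.1.1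
      exact ⟨⟨⟨γ, β.1.2.trans hγ⟩, β.2.trans hγ⟩,
        fun y hy => c.Uα_mono (β := ⟨γ, β.1.2.trans hγ⟩) hγ ⟨_, hy⟩,
        fun y hy => c.Uα_mono (β := ⟨γ, β.1.2.trans hγ⟩) hγ' ⟨_, hy⟩⟩)
  exact ⟨β.1, β.2, hβ⟩

end WellFilledChart

namespace WellFilledChart

variable {A : Type v} [Preorder A] {M : Type u} [TopologicalSpace M]
  {F : DirectedFamily A M} {E : HausdorffTVS.{w}} (c : WellFilledChart F E)

/-- Segments between points close to `q`, drawn in the chart, stay close to `q`. -/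
theorem isOpen_and_segment {f : M → E} {g : E → M} (hfc : ContinuousOn f c.U)
    (hgc : ContinuousOn g c.V) (hf : ∀ x : c.U, f x = c.φ x)
    (hg : ∀ y : c.V, g y = c.φ.symm y) {q : M} (hq : q ∈ c.core) {W : Set M} (hW : IsOpen W)
    (hqW : q ∈ W) :
    ∃ W', IsOpen W' ∧ q ∈ W' ∧ W' ⊆ W ∧ W' ⊆ c.core ∧ ∀ x ∈ W', ∀ y ∈ W', ∀ t ∈ Icc (0 : ℝ) 1,
      t • f x + (1 - t) • f y ∈ c.V ∧ g (t • f x + (1 - t) • f y) ∈ W := by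
  obtain ⟨O, hO, hV2⟩ := c.V2_relOpen
  have hmem : ∀ x ∈ c.U, f x ∈ c.V := fun x hx => hf ⟨x, hx⟩ ▸ Subtype.coe_prop _
  have hgf : ∀ x ∈ c.U, g (f x) = x := fun x hx => by
    rw [hf ⟨x, hx⟩, hg, Homeomorph.symm_apply_apply]
  -- Since `V` need not be open in `E`, the condition is only imposed on points of `V`; that
  -- segments remain in `V` comes from (e).
  have hs : {v | v ∈ c.V → g v ∈ W} ∈ 𝓝 (f q) := by
    have := (hgc (f q) (hmem q hq.1)).eventually_mem (hW.mem_nhds ((hgf q hq.1).symm ▸ hqW))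
    exact eventually_nhdsWithin_iff.1 this
  obtain ⟨O', hO', hqO', hseg⟩ := eventually_segment_mem hs
  have hcore : ∀ x ∈ c.core, f x ∈ c.V2 := fun x ⟨h, h'⟩ => hf ⟨x, h⟩ ▸ h'
  have hcore' : ∀ x ∈ c.U, f x ∈ O → x ∈ c.core := fun x hx h =>
    ⟨hx, hf ⟨x, hx⟩ ▸ hV2 ▸ ⟨hmem x hx, h⟩⟩
  refine ⟨(c.U ∩ f ⁻¹' (O ∩ O')) ∩ W, (hfc.isOpen_inter_preimage c.isOpen_U (hO.inter hO')).inter hW,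
    ⟨⟨hq.1, (hV2 ▸ hcore q hq).2, hqO'⟩, hqW⟩, inter_subset_right,
    fun x hx => hcore' x hx.1.1 hx.1.2.1, fun x hx y hy t ht => ?_⟩
  have : t • f x + (1 - t) • f y ∈ c.V := c.conv2_V2
    ⟨_, hcore x (hcore' x hx.1.1 hx.1.2.1), _, hcore y (hcore' y hy.1.1 hy.1.2.1), t, ht, rfl⟩
  exact ⟨this, hseg _ hx.1.2.2 _ hy.1.2.2 t ht this⟩

variable [IsDirectedOrder A]

/-- If a map from the base of a cone into `M_α` takes its values in the core of a chart, then its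
cone in the chart, with apex in `M_∞`, is a map into some `M_β`. -/
theorem exists_lift_cone {f : M → E} {g : E → M} (hf : ∀ x : c.U, f x = c.φ x)
    (hg : ∀ y : c.V, g y = c.φ.symm y) {X : Type*} [TopologicalSpace X] {D B : Set X}
    (P : ConePair D B) {u : X → M} (hu : MapsTo u B c.core) {q : M} (hq : q ∈ c.core)
    (hq' : q ∈ F.union) {α : A} (hlift : F.LiftsOn α B u) :
    ∃ β, α ≤ β ∧ F.LiftsOn β D (g ∘ P.cone (f ∘ u) (f q)) := by
  obtain ⟨G, hG, hGu⟩ := hlift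
  obtain ⟨α₁, y₁, hy₁, rfl⟩ := c.exists_mem_Uα hq.1 hq'
  obtain ⟨β₁, hβ₁, h₁⟩ := c.exists_image_subset_Uα (P.isCompact_base.image_of_continuousOn hG) (by
    rintro _ ⟨x, hx, rfl⟩
    rw [hGu x hx]
    exact (hu hx).1)
  -- A common index at which both the apex and the image of the base lie in the domain of `φ_β`.
  obtain ⟨b, hb₁, hb₂⟩ := exists_ge_ge α₁.1 β₁.1
  let β : Ici c.α₀ := ⟨b, α₁.2.trans hb₁⟩
  have hα₁ : α₁ ≤ β := hb₁
  have hβ : β₁ ≤ β := hb₂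
  have hαβ : α ≤ β.1 := hβ₁.trans hb₂
  have hy : F.trans hα₁ y₁ ∈ c.Uα β := c.Uα_mono hα₁ ⟨y₁, hy₁⟩
  have hGβ : ∀ x ∈ B, F.trans hαβ (G x) ∈ c.Uα β := fun x hx =>
    c.Uα_mono hβ ⟨_, h₁ _ (mem_image_of_mem _ hx)⟩
  have : Nonempty (F.Space β.1) := ⟨F.trans hα₁ y₁⟩
  obtain ⟨fβ, -, hfβ, -, efβ, -⟩ := (c.φα β).exists_extend
  have hlam : ∀ x ∈ c.Uα β, c.lam β (fβ x) = f (F.incl β.1 x) := fun x hx => by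
    rw [efβ ⟨x, hx⟩, hf ⟨_, c.Uα_subset β ⟨x, hx⟩⟩, c.φ_eq]
  have hGc : ContinuousOn (fun x => fβ (F.trans hαβ (G x))) B :=
    hfβ.comp ((F.trans hαβ).continuous.comp_continuousOn hG) hGβ
  have hcore : ∀ x ∈ c.core, f x ∈ c.V2 := fun x ⟨h, h'⟩ => hf ⟨x, h⟩ ▸ h'
  -- Condition (f) for the compact set consisting of the apex and the image of the base: all
  -- segments of the cone lie in `V_γ`.
  obtain ⟨γ, hγ, hconv⟩ := c.conv2_compact β
    (insert (fβ (F.trans hα₁ y₁)) ((fun x => fβ (F.trans hαβ (G x))) '' B))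
    ((P.isCompact_base.image_of_continuousOn hGc).insert _)
    (by
      rintro _ (rfl | ⟨x, hx, rfl⟩)
      · exact efβ ⟨_, hy⟩ ▸ Subtype.coe_prop _
      · change fβ _ ∈ _
        rw [efβ ⟨_, hGβ x hx⟩]
        exact Subtype.coe_prop _)
    (by
      rintro _ ⟨_, rfl | ⟨x, hx, rfl⟩, rfl⟩
      · rw [hlam _ hy]
        exact hcore _ hq
      · rw [hlam _ (hGβ x hx), F.incl_trans, hGu x hx]
        exact hcore _ (hu hx))
  have : Nonempty (F.Space γ.1) := ⟨F.trans hγ (F.trans hα₁ y₁)⟩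
  obtain ⟨-, gγ, -, hgγ, -, egγ⟩ := (c.φα γ).exists_extend
  have hlam' : ∀ x ∈ c.Uα β, c.lam γ (c.lamTrans hγ (fβ x)) = f (F.incl β.1 x) := fun x hx => by
    rw [efβ ⟨x, hx⟩, ← c.φα_eq hγ ⟨x, hx⟩, ← c.φ_eq, hf ⟨_, c.Uα_subset β ⟨x, hx⟩⟩]
    rfl
  let v : X → c.Eα γ := fun x => c.lamTrans hγ (fβ (F.trans hαβ (G x)))
  have hv : ContinuousOn v B := (c.lamTrans hγ).continuous.comp_continuousOn hGc
  let k := P.cone v (c.lamTrans hγ (fβ (F.trans hα₁ y₁)))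
  have hk : MapsTo k D (c.Vα γ) := fun x hx => hconv <| by
    have := P.cone_mem_conv2 v (c.lamTrans hγ (fβ (F.trans hα₁ y₁))) hx
    rwa [image_insert_eq, image_image]
  refine ⟨γ.1, hαβ.trans hγ, gγ ∘ k, hgγ.comp (P.continuousOn_cone hv _) hk, fun x hx => ?_⟩
  -- By linearity, `Λ_γ` carries the cone formed in `E_γ` to the cone formed in `E`. At `r = 0` the
  -- point `s x` is uncontrolled, but its term vanishes.
  have hlk : c.lam γ (k x) = P.cone (f ∘ u) (f (F.incl α₁.1 y₁)) x := by
    simp only [k, ConePair.cone, v, map_add, map_smul]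
    rw [hlam' _ hy, F.incl_trans]
    by_cases h : P.r x = 0
    · simp [h]
    · have := P.s_mem x hx h
      rw [hlam' _ (hGβ _ this), F.incl_trans, hGu _ this]
      rfl
  rw [Function.comp_apply, Function.comp_apply, ← hlk]
  have e := c.φ_eq γ ((c.φα γ).symm ⟨k x, hk hx⟩)
  rw [Homeomorph.apply_symm_apply] at e
  have e' := egγ ⟨k x, hk hx⟩
  simp only at e e'
  rw [← e, hg, Homeomorph.symm_apply_apply, e']

end WellFilledChart

/-- Maps from the base of a cone into a small set extend to the cone, in such a way that maps into
some `M_α` extend to maps into some `M_β`. -/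
theorem exists_cone_extension {A : Type v} [Preorder A] [IsDirectedOrder A] {M : Type u}
    [TopologicalSpace M] {F : DirectedFamily A M} (hdense : Dense F.union)
    (hcharts : AdmitsWellFilledCharts.{u, v, w} F) {q : M} {W : Set M} (hW : IsOpen W)
    (hq : q ∈ W) :
    ∃ W', IsOpen W' ∧ q ∈ W' ∧ W' ⊆ W ∧ ∀ (X : Type) [TopologicalSpace X] (D B : Set X),
      ConePair D B → ∀ u : X → M, ContinuousOn u B → MapsTo u B W' →
        ∃ u', ContinuousOn u' D ∧ MapsTo u' D W ∧ EqOn u' u B ∧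
          ∀ α, F.LiftsOn α B u → ∃ β, α ≤ β ∧ F.LiftsOn β D u' := by
  obtain ⟨E, c, hqc⟩ := hcharts q
  have : Nonempty M := ⟨q⟩
  obtain ⟨f, g, hfc, hgc, hf, hg⟩ := c.φ.exists_extend
  obtain ⟨W', hW', hqW', hsub, hcore, hseg⟩ := c.isOpen_and_segment hfc hgc hf hg hqc hW hq
  refine ⟨W', hW', hqW', hsub, fun X _ D B P u hu huW => ?_⟩
  -- Density enters here: the apex is taken in `M_∞`, near `q` but not `q` itself, which need not
  -- lie in any `M_α`.
  obtain ⟨p, hpW, hp⟩ := hdense.inter_open_nonempty W' hW' ⟨q, hqW'⟩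
  have hmem : ∀ x ∈ D, P.cone (f ∘ u) (f p) x ∈ c.V ∧ g (P.cone (f ∘ u) (f p) x) ∈ W := by
    intro x hx
    obtain ⟨a, ha, e⟩ := P.exists_cone_eq (f ∘ u) (f p) hx
    rw [e]
    obtain rfl | ⟨y, hy, rfl⟩ := ha
    · exact hseg p hpW p hpW _ (P.r_mem x hx)
    · exact hseg _ (huW hy) p hpW _ (P.r_mem x hx)
  have hfu : ContinuousOn (f ∘ u) B := hfc.comp hu fun x hx => (hcore (huW hx)).1
  refine ⟨g ∘ P.cone (f ∘ u) (f p), hgc.comp (P.continuousOn_cone hfu _) fun x hx => (hmem x hx).1,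
    fun x hx => (hmem x hx).2, fun x hx => ?_, fun α hα =>
      c.exists_lift_cone hf hg P (fun x hx => hcore (huW hx)) (hcore hpW) hp hα⟩
  rw [Function.comp_apply, P.cone_eq _ _ hx, Function.comp_apply, hf ⟨u x, (hcore (huW hx)).1⟩, hg,
    Homeomorph.symm_apply_apply]

/-! ### Deforming a map into some `M_α`, cell by cell -/

/-- On the set `S`, the map `H` is a homotopy from `f` to a map into `M_α`. -/
structure DirectedFamily.Deforms {A : Type v} [Preorder A] {M : Type u} [TopologicalSpace M]
    (F : DirectedFamily A M) {X : Type*} [TopologicalSpace X] (f : X → M) (α : A) (S : Set X)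
    (H : X × ℝ → M) : Prop where
  continuousOn : ContinuousOn H (S ×ˢ Icc 0 1)
  zero : ∀ x ∈ S, H (x, 0) = f x
  lifts : F.LiftsOn α S fun x => H (x, 1)

/-- A homotopy from `f` to a map into `M_α`, given on `S`, extends to a cell `D` attached to `S`
along `B`, if all data are small. -/
theorem exists_deforms_extension {A : Type v} [Preorder A] [IsDirectedOrder A] {M : Type u}
    [TopologicalSpace M] {F : DirectedFamily A M} (hdense : Dense F.union)
    (hcharts : AdmitsWellFilledCharts.{u, v, w} F) {q : M} {W : Set M} (hW : IsOpen W)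
    (hq : q ∈ W) :
    ∃ W', IsOpen W' ∧ q ∈ W' ∧ ∀ (X : Type) [TopologicalSpace X] [T2Space X] (S D B : Set X),
      IsClosed S → IsClosed D → ConePair D B →
      ConePair (D ×ˢ Icc (0 : ℝ) 1) (B ×ˢ Icc (0 : ℝ) 1 ∪ (D ×ˢ {0} ∪ D ×ˢ {1})) →
      B ⊆ S → D ∩ S ⊆ B → ∀ (f : X → M) (α : A) (H : X × ℝ → M), ContinuousOn f D →
      MapsTo f D W' → F.Deforms f α S H → (∀ x ∈ B, ∀ t ∈ Icc (0 : ℝ) 1, H (x, t) ∈ W') →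
      ∃ β, α ≤ β ∧ ∃ H', F.Deforms f β (S ∪ D) H' ∧ EqOn H' H (S ×ˢ Icc 0 1) ∧
        ∀ x ∈ D, ∀ t ∈ Icc (0 : ℝ) 1, H' (x, t) ∈ W := by
  classical
  -- Two cones are taken: `W₂` controls the new end map on `D`, and `W₁` the filling of the cylinder
  -- over `D`.
  obtain ⟨W₁, hW₁, hq₁, -, h₁⟩ := exists_cone_extension hdense hcharts hW hq
  obtain ⟨W₂, hW₂, hq₂, h₂₁, h₂⟩ := exists_cone_extension hdense hcharts hW₁ hq₁
  refine ⟨W₂, hW₂, hq₂, fun X _ _ S D B hS hD P Q hBS hDS f α H hf hfW hH hHW => ?_⟩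
  have hB : IsClosed B := P.isCompact_base.isClosed
  have one_mem : (1 : ℝ) ∈ Icc (0 : ℝ) 1 := right_mem_Icc.2 zero_le_one
  obtain ⟨h, hh, hhW, hhB, hlift⟩ := h₂ X D B P (fun x => H (x, 1))
    (hH.lifts.mono hBS).continuousOn fun x hx => hHW x hx 1 one_mem
  obtain ⟨β, hαβ, hβ⟩ := hlift α (hH.lifts.mono hBS)
  -- Data on the boundary of the cylinder: `f` at the bottom, the new end map `h` at the top, the
  -- given homotopy on the side.
  let u : X × ℝ → M := fun z => if z.2 = 0 then f z.1 else if z.2 = 1 then h z.1 else H z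
  have u0 : EqOn u (f ∘ Prod.fst) (D ×ˢ {0}) := fun z hz => if_pos hz.2
  have u1 : EqOn u (h ∘ Prod.fst) (D ×ˢ {1}) := fun z hz => by
    have : z.2 = 1 := hz.2
    simp [u, this]
  have uH : EqOn u H (B ×ˢ Icc 0 1) := by
    rintro ⟨x, t⟩ ⟨hx, -⟩
    change x ∈ B at hx
    by_cases h0 : t = 0
    · simp [u, h0, hH.zero x (hBS hx)]
    by_cases h1 : t = 1
    · simp [u, h1, hhB hx]
    · simp [u, h0, h1]
  have hu : ContinuousOn u (B ×ˢ Icc (0 : ℝ) 1 ∪ (D ×ˢ {0} ∪ D ×ˢ {1})) := by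
    refine ContinuousOn.union_of_isClosed ?_ (ContinuousOn.union_of_isClosed ?_ ?_
      (hD.prod isClosed_singleton) (hD.prod isClosed_singleton)) (hB.prod isClosed_Icc)
      ((hD.prod isClosed_singleton).union (hD.prod isClosed_singleton))
    · exact (hH.continuousOn.mono (prod_mono hBS Subset.rfl)).congr uH
    · exact (hf.comp continuousOn_fst fun z hz => hz.1).congr u0
    · exact (hh.comp continuousOn_fst fun z hz => hz.1).congr u1
  have huW : MapsTo u (B ×ˢ Icc (0 : ℝ) 1 ∪ (D ×ˢ {0} ∪ D ×ˢ {1})) W₁ := by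
    rintro z (hz | hz | hz)
    · rw [uH hz]
      exact h₂₁ (hHW _ hz.1 _ hz.2)
    · rw [u0 hz]
      exact h₂₁ (hfW hz.1)
    · rw [u1 hz]
      exact hhW hz.1
  -- No lift of the filling is needed: only its end map `h` must take values in some `M_β`.
  obtain ⟨K, hK, hKW, hKu, -⟩ := h₁ (X × ℝ) _ _ Q u hu huW
  let H' := (S ×ˢ (univ : Set ℝ)).piecewise H K
  have eS : EqOn H' H (S ×ˢ Icc 0 1) := fun z hz =>
    piecewise_eq_of_mem _ _ _ ⟨hz.1, mem_univ _⟩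
  have eD : EqOn H' K (D ×ˢ Icc 0 1) := by
    intro z hz
    by_cases hzS : z.1 ∈ S
    · have hzB : z ∈ B ×ˢ Icc (0 : ℝ) 1 := ⟨hDS ⟨hz.1, hzS⟩, hz.2⟩
      rw [eS ⟨hzS, hz.2⟩, hKu (Or.inl hzB), uH hzB]
    · exact piecewise_eq_of_notMem _ _ _ fun h => hzS h.1
  have eD0 : ∀ x ∈ D, H' (x, 0) = f x := fun x hx => by
    have h0 : (x, (0 : ℝ)) ∈ D ×ˢ {(0 : ℝ)} := ⟨hx, rfl⟩
    rw [eD ⟨hx, left_mem_Icc.2 zero_le_one⟩, hKu (Or.inr (Or.inl h0)), u0 h0]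
    rfl
  have eD1 : ∀ x ∈ D, H' (x, 1) = h x := fun x hx => by
    have h1 : (x, (1 : ℝ)) ∈ D ×ˢ {(1 : ℝ)} := ⟨hx, rfl⟩
    rw [eD ⟨hx, one_mem⟩, hKu (Or.inr (Or.inr h1)), u1 h1]
    rfl
  refine ⟨β, hαβ, H', ⟨?_, ?_, ?_⟩, eS, fun x hx t ht => ?_⟩
  · rw [union_prod]
    exact (hH.continuousOn.congr eS).union_of_isClosed (hK.congr eD) (hS.prod isClosed_Icc)
      (hD.prod isClosed_Icc)
  · rintro x (hx | hx)
    · rw [eS ⟨hx, left_mem_Icc.2 zero_le_one⟩, hH.zero x hx]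
    · exact eD0 x hx
  · exact ((hH.lifts.of_le hαβ).congr fun x hx => eS ⟨hx, one_mem⟩).union (hβ.congr eD1) hS hD
  · rw [eD ⟨hx, ht⟩]
    exact hKW ⟨hx, ht⟩

/-! ### The cells of a cubical grid -/

section BallCone

variable {X V : Type*} [NormedAddCommGroup V] [NormedSpace ℝ V]

/-- In the maximum norm of `V × ℝ`, the unit ball is the product of the unit balls; `t ↦ 2t - 1`
takes `[0,1]` to `[-1,1]`. Thus cylinders become balls. -/
theorem preimage_prod_closedBall (e : X → V) (P : Submodule ℝ V) :
    (fun z : X × ℝ => (e z.1, 2 * z.2 - 1)) ⁻¹' ((P.prod ⊤ : Submodule ℝ (V × ℝ)) ∩ Metric.closedBall (0 : V × ℝ) 1) =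
      (e ⁻¹' (P ∩ Metric.closedBall 0 1)) ×ˢ Icc (0 : ℝ) 1 := by
  ext ⟨x, t⟩
  simp only [mem_preimage, mem_inter_iff, SetLike.mem_coe, Submodule.mem_prod, Submodule.mem_top,
    and_true, mem_closedBall_zero_iff, Prod.norm_mk, max_le_iff, Real.norm_eq_abs, abs_le,
    mem_prod, mem_Icc]
  constructor
  · rintro ⟨h, h', h₁, h₂⟩
    exact ⟨⟨h, h'⟩, by linarith, by linarith⟩
  · rintro ⟨⟨h, h'⟩, h₁, h₂⟩
    exact ⟨h, h', by linarith, by linarith⟩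

theorem preimage_prod_sphere (e : X → V) (P : Submodule ℝ V) :
    (fun z : X × ℝ => (e z.1, 2 * z.2 - 1)) ⁻¹' ((P.prod ⊤ : Submodule ℝ (V × ℝ)) ∩ Metric.sphere (0 : V × ℝ) 1) =
      (e ⁻¹' (P ∩ Metric.sphere 0 1)) ×ˢ Icc (0 : ℝ) 1 ∪
        ((e ⁻¹' (P ∩ Metric.closedBall 0 1)) ×ˢ {0} ∪
          (e ⁻¹' (P ∩ Metric.closedBall 0 1)) ×ˢ {1}) := by
  ext ⟨x, t⟩
  simp only [mem_preimage, mem_inter_iff, SetLike.mem_coe, Submodule.mem_prod, Submodule.mem_top,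
    and_true, mem_closedBall_zero_iff, mem_sphere_zero_iff_norm, Prod.norm_mk, Real.norm_eq_abs,
    mem_prod, mem_Icc, mem_union, mem_singleton_iff]
  constructor
  · rintro ⟨h, h'⟩
    have h₁ : ‖e x‖ ≤ 1 := (le_max_left _ _).trans_eq h'
    have h₂ : |2 * t - 1| ≤ 1 := (le_max_right _ _).trans_eq h'
    rw [abs_le] at h₂
    rcases max_choice ‖e x‖ |2 * t - 1| with h₃ | h₃
    · exact Or.inl ⟨⟨h, h₃ ▸ h'⟩, by linarith, by linarith⟩
    · rw [h₃, abs_eq zero_le_one] at h'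
      rcases h' with h' | h'
      · exact Or.inr (Or.inr ⟨⟨h, h₁⟩, by linarith⟩)
      · exact Or.inr (Or.inl ⟨⟨h, h₁⟩, by linarith⟩)
  · rintro (⟨⟨h, h'⟩, h₁, h₂⟩ | ⟨⟨h, h'⟩, rfl⟩ | ⟨⟨h, h'⟩, rfl⟩)
    · exact ⟨h, by rw [h', max_eq_left (abs_le.2 ⟨by linarith, by linarith⟩)]⟩
    · exact ⟨h, by rw [max_eq_right] <;> norm_num [h']⟩
    · exact ⟨h, by rw [max_eq_right] <;> norm_num [h']⟩

variable [TopologicalSpace X] [FiniteDimensional ℝ V]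

/-- The unit ball of a subspace is a cone over the unit sphere. -/
noncomputable def ConePair.ball (e : X ≃ₜ V) (P : Submodule ℝ V) :
    ConePair (e ⁻¹' (P ∩ Metric.closedBall 0 1)) (e ⁻¹' (P ∩ Metric.sphere 0 1)) where
  r x := ‖e x‖
  s x := e.symm (‖e x‖⁻¹ • e x)
  base_subset := preimage_mono (inter_subset_inter_right _ Metric.sphere_subset_closedBall)
  isCompact_base := by
    have : ProperSpace V := FiniteDimensional.proper ℝ V
    rw [← e.image_symm]
    exact ((isCompact_sphere 0 1).inter_left P.closed_of_finiteDimensional).image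
      e.symm.continuous
  continuousOn_r := by fun_prop
  r_mem x hx := ⟨norm_nonneg _, mem_closedBall_zero_iff.1 hx.2⟩
  s_mem x hx h := by
    refine ⟨?_, ?_⟩
    · rw [e.apply_symm_apply]
      exact P.smul_mem _ hx.1
    · rw [e.apply_symm_apply, mem_sphere_zero_iff_norm, norm_smul, norm_inv, norm_norm,
        inv_mul_cancel₀ h]
  continuousOn_s := by
    refine e.symm.continuous.comp_continuousOn (ContinuousOn.smul (ContinuousOn.inv₀ ?_ ?_) ?_)
    · fun_prop
    · exact fun x hx => hx.2
    · fun_prop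
  r_eq x hx := mem_sphere_zero_iff_norm.1 hx.2
  s_eq x hx := by simp [mem_sphere_zero_iff_norm.1 hx.2]

/-- The cylinder on the unit ball is a cone over its boundary. -/
theorem ConePair.nonempty_ball_prod (e : X ≃ₜ V) (P : Submodule ℝ V) :
    Nonempty (ConePair ((e ⁻¹' (P ∩ Metric.closedBall 0 1)) ×ˢ Icc (0 : ℝ) 1)
      ((e ⁻¹' (P ∩ Metric.sphere 0 1)) ×ˢ Icc (0 : ℝ) 1 ∪
        ((e ⁻¹' (P ∩ Metric.closedBall 0 1)) ×ˢ {0} ∪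
          (e ⁻¹' (P ∩ Metric.closedBall 0 1)) ×ˢ {1}))) := by
  rw [← preimage_prod_sphere, ← preimage_prod_closedBall]
  let l : ℝ ≃ₜ ℝ := (Homeomorph.mulLeft₀ 2 two_ne_zero).trans (Homeomorph.subRight 1)
  exact ⟨ConePair.ball (e.prodCongr l) (P.prod ⊤)⟩

end BallCone

namespace CubicalGrid

variable {ι : Type} (N : ℕ) (c : ι → ℤ)

/-- The coordinates on `ℝ^ι` centred at `c / (2 (N + 1))`, in which a cell has diameter 2. -/
noncomputable def chart : (ι → ℝ) ≃ₜ (ι → ℝ) :=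
  (Homeomorph.smulOfNeZero (2 * ((N : ℝ) + 1)) (by positivity)).trans
    (Homeomorph.subRight fun i => (c i : ℝ))

theorem chart_apply (x : ι → ℝ) (i : ι) : chart N c x i = 2 * ((N : ℝ) + 1) * x i - c i := rfl

variable [Fintype ι]

/-- The directions of the cell with centre `c / (2 (N + 1))`. -/
def directions : Submodule ℝ (ι → ℝ) := Submodule.pi {i | Even (c i)} fun _ => ⊥

/-- The cell with centre `c / (2 (N + 1))` of the decomposition of the unit cube into cubes of side
length `1 / (N + 1)`: it extends in the directions `i` for which `c i` is odd. -/
def cell : Set (ι → ℝ) := chart N c ⁻¹' (directions c ∩ Metric.closedBall 0 1)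

/-- The relative boundary of a cell. -/
def cellBoundary : Set (ι → ℝ) := chart N c ⁻¹' (directions c ∩ Metric.sphere 0 1)

/-- The dimension of a cell. -/
noncomputable def dim : ℕ := by classical exact (Finset.univ.filter fun i => Odd (c i)).card

variable {N c}

theorem mem_cell {x : ι → ℝ} : x ∈ cell N c ↔
    (∀ i, Even (c i) → 2 * ((N : ℝ) + 1) * x i = c i) ∧
      ∀ i, |2 * ((N : ℝ) + 1) * x i - c i| ≤ 1 := by
  simp [cell, directions, pi_norm_le_iff_of_nonneg, chart_apply, sub_eq_zero]

theorem cellBoundary_subset : cellBoundary N c ⊆ cell N c := (ConePair.ball _ _).base_subset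

theorem mem_cellBoundary {x : ι → ℝ} : x ∈ cellBoundary N c ↔
    x ∈ cell N c ∧ ∃ i, |2 * ((N : ℝ) + 1) * x i - c i| = 1 := by
  refine ⟨fun h => ⟨cellBoundary_subset h, ?_⟩, fun ⟨h, i, hi⟩ => ⟨h.1, ?_⟩⟩
  · by_contra! h'
    have h1 : ‖chart N c x‖ = 1 := mem_sphere_zero_iff_norm.1 h.2
    refine ne_of_lt ((pi_norm_lt_iff one_pos).2 fun i => ?_) h1
    exact lt_of_le_of_ne ((mem_cell.1 (cellBoundary_subset h)).2 i) (h' i)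
  · rw [mem_sphere_zero_iff_norm]
    refine le_antisymm (mem_closedBall_zero_iff.1 h.2) ?_
    exact hi.symm.le.trans (norm_le_pi_norm (chart N c x) i)

theorem isClosed_cell : IsClosed (cell N c) :=
  ((directions c).closed_of_finiteDimensional.inter Metric.isClosed_closedBall).preimage
    (chart N c).continuous

variable (ι) in
/-- The boundary of the unit cube. -/
def cubeBoundary : Set (ι → ℝ) := {x | x ∈ Icc 0 1 ∧ ∃ i, x i = 0 ∨ x i = 1}

theorem isClosed_cubeBoundary : IsClosed (cubeBoundary ι) := by
  have : cubeBoundary ι = Icc 0 1 ∩ ⋃ i, ({x | x i = 0} ∪ {x | x i = 1}) := by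
    ext x
    simp [cubeBoundary]
  rw [this]
  refine isClosed_Icc.inter (isClosed_iUnion_of_finite fun i => ?_)
  exact (isClosed_eq (continuous_apply i) continuous_const).union
    (isClosed_eq (continuous_apply i) continuous_const)

variable (ι N) in
/-- The (centres of the) cells in the interior of the unit cube. -/
noncomputable def interiorCells : Finset (ι → ℤ) := by
  -- The even values `0` and `2 (N + 1)` are excluded: there the cell would lie in a face of the
  -- unit cube.
  classical exact Finset.Icc (fun _ => 1) (fun _ => 2 * N + 1)

theorem mem_interiorCells : c ∈ interiorCells ι N ↔ ∀ i, 1 ≤ c i ∧ c i ≤ 2 * N + 1 := by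
  simp [interiorCells, Pi.le_def, forall_and]

theorem cell_subset_Icc (hc : c ∈ interiorCells ι N) : cell N c ⊆ Icc 0 1 := by
  intro x hx
  have key : ∀ i, 0 ≤ x i ∧ x i ≤ 1 := fun i => by
    obtain ⟨h₁, h₂⟩ := mem_interiorCells.1 hc i
    have h₁' : (1 : ℝ) ≤ c i := by exact_mod_cast h₁
    have h₂' : (c i : ℝ) ≤ 2 * N + 1 := by exact_mod_cast h₂
    have h₃ := abs_le.1 ((mem_cell.1 hx).2 i)
    have hN : (0 : ℝ) < 2 * (N + 1) := by positivity
    constructor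
    · by_contra! h
      nlinarith
    · by_contra! h
      nlinarith
  exact ⟨fun i => (key i).1, fun i => (key i).2⟩

theorem cell_inter_cubeBoundary (hc : c ∈ interiorCells ι N) :
    cell N c ∩ cubeBoundary ι ⊆ cellBoundary N c := by
  rintro x ⟨hx, -, i, hi⟩
  refine mem_cellBoundary.2 ⟨hx, i, ?_⟩
  obtain ⟨h₁, h₂⟩ := mem_interiorCells.1 hc i
  have h₃ := (mem_cell.1 hx).2 i
  rcases hi with hi | hi <;> rw [hi] at h₃ ⊢
  · have : (1 : ℝ) ≤ c i := by exact_mod_cast h₁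
    rw [abs_le] at h₃
    rw [abs_eq zero_le_one]
    right
    linarith
  · have : (c i : ℝ) ≤ 2 * N + 1 := by exact_mod_cast h₂
    rw [abs_le] at h₃
    rw [abs_eq zero_le_one]
    left
    linarith

/-- At a common point off the boundary of the first cell, all bounds for `c` are strict. Where `c i`
is odd, parity then forces `c' i = c i`. So the directions of the first cell are among those of the
second, and are the same by dimension; in the other coordinates both cells prescribe the coordinate
of the point. -/
theorem cell_inter_cell {c' : ι → ℤ} (hne : c ≠ c') (hdim : dim c' ≤ dim c) :
    cell N c ∩ cell N c' ⊆ cellBoundary N c := by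
  classical
  rintro x ⟨hx, hx'⟩
  by_contra hb
  have hlt : ∀ i, |2 * ((N : ℝ) + 1) * x i - c i| < 1 := fun i =>
    lt_of_le_of_ne ((mem_cell.1 hx).2 i) fun h => hb (mem_cellBoundary.2 ⟨hx, i, h⟩)
  have hodd : ∀ i, Odd (c i) → Odd (c' i) ∧ c' i = c i := by
    intro i hi
    have h₁ := abs_lt.1 (hlt i)
    have h₂ := abs_le.1 ((mem_cell.1 hx').2 i)
    have h₃ : c' i < c i + 2 := by
      have : (c' i : ℝ) < c i + 2 := by linarith
      exact_mod_cast this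
    have h₄ : c i < c' i + 2 := by
      have : (c i : ℝ) < c' i + 2 := by linarith
      exact_mod_cast this
    by_cases h : Even (c' i)
    · have h₅ := (mem_cell.1 hx').1 i h
      rw [h₅] at h₁
      have h₆ : c' i < c i + 1 := by
        have : (c' i : ℝ) < c i + 1 := by linarith
        exact_mod_cast this
      have h₇ : c i < c' i + 1 := by
        have : (c i : ℝ) < c' i + 1 := by linarith
        exact_mod_cast this
      have : c' i = c i := by omega
      rw [this] at h
      exact absurd hi (Int.not_odd_iff_even.2 h)
    · rw [Int.not_even_iff_odd] at h
      obtain ⟨a, ha⟩ := hi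
      obtain ⟨b, hb⟩ := h
      exact ⟨⟨b, hb⟩, by omega⟩
  have hsub : (Finset.univ.filter fun i => Odd (c i)) ⊆ Finset.univ.filter fun i => Odd (c' i) :=
    Finset.monotone_filter_right _ fun i _ h => (hodd i h).1
  have heq := Finset.eq_of_subset_of_card_le hsub hdim
  refine hne (funext fun i => ?_)
  by_cases h : Odd (c i)
  · exact (hodd i h).2.symm
  · have h' : ¬ Odd (c' i) := fun h' => h (by
      have : i ∈ Finset.univ.filter fun i => Odd (c' i) := by simpa using h'
      rw [← heq] at this
      simpa using this)
    rw [Int.not_odd_iff_even] at h h'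
    have := ((mem_cell.1 hx).1 i h).symm.trans ((mem_cell.1 hx').1 i h')
    exact_mod_cast this

/-- In a direction `i` where the norm `1` is attained, replacing `c i` by the neighbouring even
integer `k` gives the face containing `x`. It is an interior cell because `k = 0` or `k = 2 (N + 1)`
would place `x` on the boundary of the cube. -/
theorem exists_mem_cell_of_mem_cellBoundary (hc : c ∈ interiorCells ι N) {x : ι → ℝ}
    (hx : x ∈ cellBoundary N c) (hx' : x ∉ cubeBoundary ι) :
    ∃ c' ∈ interiorCells ι N, dim c' < dim c ∧ x ∈ cell N c' := by
  classical
  obtain ⟨hxc, i, hi⟩ := mem_cellBoundary.1 hx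
  have hodd : Odd (c i) := by
    by_contra h
    rw [(mem_cell.1 hxc).1 i (Int.not_odd_iff_even.1 h)] at hi
    simp at hi
  obtain ⟨k, hk, hkc⟩ : ∃ k : ℤ, 2 * ((N : ℝ) + 1) * x i = k ∧ (k = c i + 1 ∨ k = c i - 1) := by
    rcases (abs_eq zero_le_one).1 hi with h | h
    · exact ⟨c i + 1, by push_cast; linarith, Or.inl rfl⟩
    · exact ⟨c i - 1, by push_cast; linarith, Or.inr rfl⟩
  have hN : (0 : ℝ) < 2 * (N + 1) := by positivity
  have hk0 : k ≠ 0 := by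
    rintro rfl
    refine hx' ⟨cell_subset_Icc hc hxc, i, Or.inl ?_⟩
    simpa [hN.ne'] using hk
  have hk1 : k ≠ 2 * (N + 1) := by
    rintro rfl
    refine hx' ⟨cell_subset_Icc hc hxc, i, Or.inr ?_⟩
    push_cast at hk
    exact mul_left_cancel₀ hN.ne' (hk.trans (mul_one _).symm)
  have heven : Even k := by
    rcases hkc with rfl | rfl
    · exact hodd.add_odd odd_one
    · exact hodd.sub_odd odd_one
  refine ⟨Function.update c i k, mem_interiorCells.2 fun j => ?_, ?_, mem_cell.2 ⟨fun j => ?_,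
    fun j => ?_⟩⟩
  · have := mem_interiorCells.1 hc j
    by_cases hj : j = i
    · subst hj
      simp only [Function.update_self]
      omega
    · simpa [hj] using this
  · refine Finset.card_lt_card (Finset.ssubset_iff_of_subset (fun j hj => ?_) |>.2 ⟨i, ?_, ?_⟩)
    · by_cases hji : j = i
      · subst hji
        simp only [Finset.mem_filter, Function.update_self] at hj
        exact absurd hj.2 (Int.not_odd_iff_even.2 heven)
      · simpa [hji] using hj
    · simpa using hodd
    · simpa using heven
  · by_cases hj : j = i
    · subst hj
      simpa using fun _ => hk
    · simpa [hj] using (mem_cell.1 hxc).1 j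
  · by_cases hj : j = i
    · subst hj
      simp [hk]
    · simpa [hj] using (mem_cell.1 hxc).2 j

theorem exists_mem_cell_of_mem_Icc {x : ι → ℝ} (hx : x ∈ Icc (0 : ι → ℝ) 1) :
    ∃ c ∈ interiorCells ι N, x ∈ cell N c := by
  have key : ∀ i, ∃ k : ℤ, 0 ≤ k ∧ k ≤ N ∧ |2 * ((N : ℝ) + 1) * x i - (2 * k + 1 : ℤ)| ≤ 1 := by
    intro i
    have h0 : 0 ≤ x i := hx.1 i
    have h1 : x i ≤ 1 := hx.2 i
    -- At `x i = 1` the floor would be `N + 1`, one too many, so the last interval is used.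
    by_cases h : x i = 1
    · refine ⟨N, by positivity, le_rfl, ?_⟩
      rw [h, abs_le]
      push_cast
      constructor <;> linarith
    · have h1' := lt_of_le_of_ne h1 h
      have hN : (0 : ℝ) < N + 1 := by positivity
      refine ⟨⌊((N : ℝ) + 1) * x i⌋, Int.floor_nonneg.2 (by positivity), ?_, ?_⟩
      · rw [← Int.lt_add_one_iff, Int.floor_lt]
        push_cast
        nlinarith
      · have h₁ := Int.floor_le (((N : ℝ) + 1) * x i)
        have h₂ := Int.lt_floor_add_one (((N : ℝ) + 1) * x i)
        rw [abs_le]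
        push_cast
        constructor <;> linarith
  choose k hk using key
  refine ⟨fun i => 2 * k i + 1, mem_interiorCells.2 fun i => ?_, mem_cell.2 ⟨fun i h => ?_,
    fun i => (hk i).2.2⟩⟩
  · have := hk i
    constructor <;> linarith
  · exact absurd h (by simp)

theorem dist_le_of_mem_cell {x y : ι → ℝ} (hx : x ∈ cell N c) (hy : y ∈ cell N c) :
    dist x y ≤ 1 / ((N : ℝ) + 1) := by
  have hN : (0 : ℝ) < N + 1 := by positivity
  refine (dist_pi_le_iff (by positivity)).2 fun i => ?_
  have h₁ := abs_le.1 ((mem_cell.1 hx).2 i)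
  have h₂ := abs_le.1 ((mem_cell.1 hy).2 i)
  rw [Real.dist_eq, le_div_iff₀ hN]
  calc |x i - y i| * (N + 1) = |(x i - y i) * (N + 1)| := by rw [abs_mul, abs_of_pos hN]
    _ ≤ 1 := abs_le.2 ⟨by linarith, by linarith⟩

theorem cell_nonempty : (cell N c).Nonempty := by
  refine ⟨(chart N c).symm 0, ?_⟩
  simp [cell]

end CubicalGrid

/-! ### Extending deformations over the skeleta of the grid. -/

namespace CubicalGrid

variable {ι : Type} [Fintype ι] {N : ℕ}

/-- The union of the boundary of the unit cube and a family of cells. -/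
def complex (N : ℕ) (T : Finset (ι → ℤ)) : Set (ι → ℝ) := cubeBoundary ι ∪ ⋃ c ∈ T, cell N c

theorem isClosed_complex (T : Finset (ι → ℤ)) : IsClosed (complex N T) :=
  isClosed_cubeBoundary.union (isClosed_biUnion_finset fun _ _ => isClosed_cell)

theorem complex_insert [DecidableEq (ι → ℤ)] (T : Finset (ι → ℤ)) (c : ι → ℤ) :
    complex N (insert c T) = complex N T ∪ cell N c := by
  simp only [complex, Finset.set_biUnion_insert]
  rw [union_comm (cell N c), union_assoc]

theorem complex_empty : complex N (∅ : Finset (ι → ℤ)) = cubeBoundary ι := by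
  simp [complex]

variable (ι N) in
/-- The interior cells of dimension less than `d`. -/
noncomputable def cellsBelow (d : ℕ) : Finset (ι → ℤ) := (interiorCells ι N).filter fun c => dim c < d

theorem mem_cellsBelow {d : ℕ} {c : ι → ℤ} :
    c ∈ cellsBelow ι N d ↔ c ∈ interiorCells ι N ∧ dim c < d := Finset.mem_filter

theorem cellsBelow_zero : cellsBelow ι N 0 = ∅ := by
  ext c
  simp [mem_cellsBelow]

theorem cellBoundary_subset_complex {c : ι → ℤ} (hc : c ∈ interiorCells ι N)
    {T : Finset (ι → ℤ)} (hT : cellsBelow ι N (dim c) ⊆ T) :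
    cellBoundary N c ⊆ complex N T := by
  intro x hx
  by_cases h : x ∈ cubeBoundary ι
  · exact Or.inl h
  · obtain ⟨c', hc', hd, hx'⟩ := exists_mem_cell_of_mem_cellBoundary hc hx h
    exact Or.inr (mem_biUnion (hT (mem_cellsBelow.2 ⟨hc', hd⟩)) hx')

theorem cell_inter_complex {c : ι → ℤ} (hc : c ∈ interiorCells ι N) {T : Finset (ι → ℤ)}
    (hcT : c ∉ T) (hT : ∀ c' ∈ T, dim c' ≤ dim c) :
    cell N c ∩ complex N T ⊆ cellBoundary N c := by
  rintro x ⟨hx, hx' | hx'⟩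
  · exact cell_inter_cubeBoundary hc ⟨hx, hx'⟩
  · simp only [mem_iUnion] at hx'
    obtain ⟨c', hc', hx'⟩ := hx'
    exact cell_inter_cell (by rintro rfl; exact hcT hc') (hT c' hc') ⟨hx, hx'⟩

theorem complex_cellsBelow_top :
    complex N (cellsBelow ι N (Fintype.card ι + 1)) = Icc 0 1 := by
  refine Subset.antisymm (union_subset (fun x hx => hx.1) (iUnion₂_subset fun c hc =>
    cell_subset_Icc (mem_cellsBelow.1 hc).1)) fun x hx => ?_
  obtain ⟨c, hc, hxc⟩ := exists_mem_cell_of_mem_Icc (N := N) hx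
  exact Or.inr (mem_biUnion (mem_cellsBelow.2 ⟨hc, Nat.lt_succ_of_le (Finset.card_filter_le _ _)⟩)
    hxc)

variable {A : Type v} [Preorder A] {M : Type u} [TopologicalSpace M] {F : DirectedFamily A M}

/-- A homotopy can be extended cell by cell to all cells of dimension `d`, if it can be extended
to each of them. -/
theorem exists_deforms_cells {f : (ι → ℝ) → M} {d : ℕ} {Ω Ω' : Set ((ι → ℝ) × M)} (hΩ : Ω' ⊆ Ω)
    (hcell : ∀ c ∈ interiorCells ι N, dim c = d → ∀ (S : Set (ι → ℝ)) (α : A)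
      (H : (ι → ℝ) × ℝ → M), IsClosed S → cellBoundary N c ⊆ S → cell N c ∩ S ⊆ cellBoundary N c →
      F.Deforms f α S H → (∀ x ∈ cellBoundary N c, ∀ t ∈ Icc (0 : ℝ) 1, (x, H (x, t)) ∈ Ω') →
      ∃ β, α ≤ β ∧ ∃ H', F.Deforms f β (S ∪ cell N c) H' ∧ EqOn H' H (S ×ˢ Icc 0 1) ∧
        ∀ x ∈ cell N c, ∀ t ∈ Icc (0 : ℝ) 1, (x, H' (x, t)) ∈ Ω)
    {α : A} {H : (ι → ℝ) × ℝ → M} (hH : F.Deforms f α (complex N (cellsBelow ι N d)) H)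
    (hHΩ : ∀ x ∈ complex N (cellsBelow ι N d), ∀ t ∈ Icc (0 : ℝ) 1, (x, H (x, t)) ∈ Ω') :
    ∃ β, α ≤ β ∧ ∃ H', F.Deforms f β (complex N (cellsBelow ι N (d + 1))) H' ∧
      EqOn H' H (complex N (cellsBelow ι N d) ×ˢ Icc 0 1) ∧
      ∀ x ∈ complex N (cellsBelow ι N (d + 1)), ∀ t ∈ Icc (0 : ℝ) 1, (x, H' (x, t)) ∈ Ω := by
  classical
  -- Cells of dimension `d` are added one at a time. The boundary of each lies in the part already
  -- covered by `H`, where the graph is in `Ω'`; hence one shrinking of the neighbourhood serves all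
  -- cells of this dimension.
  have key : ∀ T : Finset (ι → ℤ), (∀ c ∈ T, c ∈ interiorCells ι N ∧ dim c = d) →
      ∃ β, α ≤ β ∧ ∃ H', F.Deforms f β (complex N (T ∪ cellsBelow ι N d)) H' ∧
        EqOn H' H (complex N (cellsBelow ι N d) ×ˢ Icc 0 1) ∧
        ∀ x ∈ complex N (T ∪ cellsBelow ι N d), ∀ t ∈ Icc (0 : ℝ) 1, (x, H' (x, t)) ∈ Ω := by
    intro T
    induction T using Finset.induction_on with
    | empty =>
      intro _
      rw [Finset.empty_union]
      exact ⟨α, le_rfl, H, hH, fun _ _ => rfl, fun x hx t ht => hΩ (hHΩ x hx t ht)⟩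
    | insert c T hcT ih =>
      intro hT
      obtain ⟨β, hαβ, H', hH', hEq, hH'Ω⟩ := ih fun c hc => hT c (Finset.mem_insert_of_mem hc)
      obtain ⟨hc, hcd⟩ := hT c (Finset.mem_insert_self _ _)
      have hb : cellBoundary N c ⊆ complex N (cellsBelow ι N d) :=
        cellBoundary_subset_complex hc (hcd ▸ Finset.Subset.refl _)
      obtain ⟨γ, hβγ, H'', hH'', hEq', hΩ''⟩ := hcell c hc hcd (complex N (T ∪ cellsBelow ι N d)) β H'
        (isClosed_complex _)
        (cellBoundary_subset_complex hc (hcd ▸ Finset.subset_union_right))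
        (cell_inter_complex hc (by
          rw [Finset.mem_union, not_or]
          exact ⟨hcT, fun h => (mem_cellsBelow.1 h).2.ne hcd⟩) (by
          intro c' hc'
          rcases Finset.mem_union.1 hc' with h | h
          · exact ((hT c' (Finset.mem_insert_of_mem h)).2.trans hcd.symm).le
          · exact ((mem_cellsBelow.1 h).2.trans_eq hcd.symm).le)) hH' (by
        intro x hx t ht
        rw [hEq (mk_mem_prod (hb hx) ht)]
        exact hHΩ x (hb hx) t ht)
      have hsub : complex N (cellsBelow ι N d) ⊆ complex N (T ∪ cellsBelow ι N d) :=
        union_subset_union_right _ (biUnion_subset_biUnion_left Finset.subset_union_right)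
      rw [Finset.insert_union, complex_insert]
      refine ⟨γ, hαβ.trans hβγ, H'', hH'', (hEq'.mono (prod_mono hsub Subset.rfl)).trans hEq, ?_⟩
      rintro x (hx | hx) t ht
      · rw [hEq' (mk_mem_prod hx ht)]
        exact hH'Ω x hx t ht
      · exact hΩ'' x hx t ht
  have hU : cellsBelow ι N (d + 1) =
      ((interiorCells ι N).filter fun c => dim c = d) ∪ cellsBelow ι N d := by
    ext c
    simp only [mem_cellsBelow, Finset.mem_union, Finset.mem_filter, Nat.lt_succ_iff_lt_or_eq]
    tauto
  rw [hU]
  exact key _ fun c hc => Finset.mem_filter.1 hc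

/-- The inductive step: for a sufficiently small neighbourhood `Ω'` of the graph of `f` and a
sufficiently fine grid, homotopies with graph in `Ω'` extend to the cells with graph in `Ω`. -/
theorem exists_nhds_graph [IsDirectedOrder A] (hdense : Dense F.union)
    (hcharts : AdmitsWellFilledCharts.{u, v, w} F) {f : (ι → ℝ) → M} (hf : Continuous f)
    {Ω : Set ((ι → ℝ) × M)} (hΩ : IsOpen Ω) (hfΩ : ∀ x, (x, f x) ∈ Ω) :
    ∃ Ω' ⊆ Ω, IsOpen Ω' ∧ (∀ x, (x, f x) ∈ Ω') ∧ ∃ N₀ : ℕ, ∀ N ≥ N₀, ∀ c ∈ interiorCells ι N,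
      ∀ (S : Set (ι → ℝ)) (α : A)
      (H : (ι → ℝ) × ℝ → M), IsClosed S → cellBoundary N c ⊆ S → cell N c ∩ S ⊆ cellBoundary N c →
      F.Deforms f α S H → (∀ x ∈ cellBoundary N c, ∀ t ∈ Icc (0 : ℝ) 1, (x, H (x, t)) ∈ Ω') →
      ∃ β, α ≤ β ∧ ∃ H', F.Deforms f β (S ∪ cell N c) H' ∧ EqOn H' H (S ×ˢ Icc 0 1) ∧
        ∀ x ∈ cell N c, ∀ t ∈ Icc (0 : ℝ) 1, (x, H' (x, t)) ∈ Ω := by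
  have hloc : ∀ x, ∃ (B : Set (ι → ℝ)) (W W' : Set M), IsOpen B ∧ x ∈ B ∧ B ×ˢ W ⊆ Ω ∧ IsOpen W' ∧
      MapsTo f B W' ∧ ∀ (X : Type) [TopologicalSpace X] [T2Space X] (S D B : Set X),
      IsClosed S → IsClosed D → ConePair D B →
      ConePair (D ×ˢ Icc (0 : ℝ) 1) (B ×ˢ Icc (0 : ℝ) 1 ∪ (D ×ˢ {0} ∪ D ×ˢ {1})) →
      B ⊆ S → D ∩ S ⊆ B → ∀ (f : X → M) (α : A) (H : X × ℝ → M), ContinuousOn f D →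
      MapsTo f D W' → F.Deforms f α S H → (∀ x ∈ B, ∀ t ∈ Icc (0 : ℝ) 1, H (x, t) ∈ W') →
      ∃ β, α ≤ β ∧ ∃ H', F.Deforms f β (S ∪ D) H' ∧ EqOn H' H (S ×ˢ Icc 0 1) ∧
        ∀ x ∈ D, ∀ t ∈ Icc (0 : ℝ) 1, H' (x, t) ∈ W := by
    intro x
    obtain ⟨B, W, hB, hW, hxB, hxW, hBW⟩ := isOpen_prod_iff.1 hΩ x (f x) (hfΩ x)
    obtain ⟨W', hW', hxW', h⟩ := exists_deforms_extension hdense hcharts hW hxW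
    exact ⟨B ∩ f ⁻¹' W', W, W', hB.inter (hW'.preimage hf), ⟨hxB, hxW'⟩,
      (prod_mono inter_subset_left Subset.rfl).trans hBW, hW', fun x hx => hx.2, h⟩
  choose B W W' hB hxB hBW hW' hfW' hext using hloc
  obtain ⟨s, -, hs⟩ := (isCompact_Icc (a := (0 : ι → ℝ)) (b := 1)).elim_nhds_subcover B
    fun x _ => (hB x).mem_nhds (hxB x)
  obtain ⟨δ, hδ, hLeb⟩ := lebesgue_number_lemma_of_metric
    (isCompact_Icc (a := (0 : ι → ℝ)) (b := 1)) (c := fun x : s => B x) (fun x => hB x) (by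
      intro x hx
      obtain ⟨y, hy, h⟩ := mem_iUnion₂.1 (hs hx)
      exact mem_iUnion.2 ⟨⟨y, hy⟩, h⟩)
  -- Points at distance at least `δ / 2` from the complement of `B x`. Closedness of `C x` makes the
  -- condition "over `C x`, the value lies in `W' x`" open, and it holds on the graph of `f`.
  let C : (ι → ℝ) → Set (ι → ℝ) := fun x => (Metric.thickening (δ / 2) (B x)ᶜ)ᶜ
  have hC : ∀ x, C x ⊆ B x := fun x =>
    compl_subset_comm.1 (Metric.self_subset_thickening (half_pos hδ) _)
  have hCc : ∀ x, IsClosed (C x) := fun x => Metric.isOpen_thickening.isClosed_compl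
  obtain ⟨N₀, hN₀⟩ := exists_nat_one_div_lt (half_pos hδ)
  refine ⟨Ω ∩ ⋂ x ∈ s, (Prod.fst ⁻¹' (C x)ᶜ ∪ Prod.snd ⁻¹' W' x), inter_subset_left,
    hΩ.inter (isOpen_biInter_finset fun x _ => ((hCc x).isOpen_compl.preimage continuous_fst).union
      ((hW' x).preimage continuous_snd)), fun y => ⟨hfΩ y, mem_iInter₂.2 fun x _ => ?_⟩,
    N₀, fun N hN c hc S α H hS hcS hSc hH hHΩ => ?_⟩
  · by_cases hy : y ∈ C x
    · exact Or.inr (hfW' x (hC x hy))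
    · exact Or.inl hy
  · obtain ⟨m, hm⟩ := cell_nonempty (N := N) (c := c)
    obtain ⟨⟨x, hx⟩, hball⟩ := hLeb m (cell_subset_Icc hc hm)
    -- A cell has diameter less than `δ / 2` and contains a point whose `δ`-ball is in `B x`, so the
    -- whole cell is in `C x`.
    have hNδ : 1 / ((N : ℝ) + 1) < δ / 2 := lt_of_le_of_lt (by gcongr) hN₀
    have hcell : cell N c ⊆ C x := by
      intro y hy hy'
      obtain ⟨z, hz, hyz⟩ := Metric.mem_thickening_iff.1 hy'
      refine hz (hball ?_)
      have h₁ := dist_le_of_mem_cell hy hm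
      have h₂ := dist_triangle_left z m y
      rw [Metric.mem_ball]
      linarith
    obtain ⟨Q⟩ := ConePair.nonempty_ball_prod (chart N c) (directions c)
    obtain ⟨β, hαβ, H', hH', hEq, hH'W⟩ := hext x (ι → ℝ) S (cell N c) (cellBoundary N c) hS
      isClosed_cell (ConePair.ball (chart N c) (directions c)) Q hcS hSc f α H hf.continuousOn
      (fun y hy => hfW' x (hC x (hcell hy))) hH (by
        intro y hy t ht
        have h := mem_iInter₂.1 (hHΩ y hy t ht).2 x hx
        exact h.resolve_left fun h => h (hcell (cellBoundary_subset hy)))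
    exact ⟨β, hαβ, H', hH', hEq, fun y hy t ht => hBW x ⟨hC x (hcell hy), hH'W y hy t ht⟩⟩

/-- The map `f` can be deformed into some `M_α` on the `(d - 1)`-skeleton of every sufficiently fine
grid, with graph in a given neighbourhood of the graph of `f`. -/
theorem exists_deforms_skeleton [IsDirectedOrder A] (hdense : Dense F.union)
    (hcharts : AdmitsWellFilledCharts.{u, v, w} F) {f : (ι → ℝ) → M} (hf : Continuous f)
    {α₀ : A} (hlift : F.LiftsOn α₀ (cubeBoundary ι) f) (d : ℕ) :
    ∀ Ω : Set ((ι → ℝ) × M), IsOpen Ω → (∀ x, (x, f x) ∈ Ω) → ∃ N₀ : ℕ, ∀ N ≥ N₀,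
      ∃ α, α₀ ≤ α ∧ ∃ H, F.Deforms f α (complex N (cellsBelow ι N d)) H ∧
        (∀ x ∈ cubeBoundary ι, ∀ t ∈ Icc (0 : ℝ) 1, H (x, t) = f x) ∧
        ∀ x ∈ complex N (cellsBelow ι N d), ∀ t ∈ Icc (0 : ℝ) 1, (x, H (x, t)) ∈ Ω := by
  induction d with
  | zero =>
    intro Ω hΩ hfΩ
    refine ⟨0, fun N _ => ⟨α₀, le_rfl, fun z => f z.1, ?_, fun _ _ _ _ => rfl, fun x _ _ _ => hfΩ x⟩⟩
    rw [cellsBelow_zero, complex_empty]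
    exact ⟨(hf.comp continuous_fst).continuousOn, fun _ _ => rfl, hlift⟩
  | succ d ih =>
    intro Ω hΩ hfΩ
    -- The neighbourhood `Ω'` does not depend on the grid, so the induction hypothesis applies to it
    -- for all large `N`.
    obtain ⟨Ω', hsub, hΩ', hfΩ', N₁, h₁⟩ := exists_nhds_graph hdense hcharts hf hΩ hfΩ
    obtain ⟨N₂, h₂⟩ := ih Ω' hΩ' hfΩ'
    refine ⟨max N₁ N₂, fun N hN => ?_⟩
    obtain ⟨α, hα, H, hH, hbd, hHΩ⟩ := h₂ N ((le_max_right _ _).trans hN)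
    obtain ⟨β, hβ, H', hH', hEq, hH'Ω⟩ := exists_deforms_cells hsub
      (fun c hc _ => h₁ N ((le_max_left _ _).trans hN) c hc) hH hHΩ
    refine ⟨β, hα.trans hβ, H', hH', fun x hx t ht => ?_, hH'Ω⟩
    rw [hEq (mk_mem_prod (Or.inl hx) ht), hbd x hx t ht]

end CubicalGrid

/-- A map on the unit cube whose restriction to the boundary is a map to `M_α` is homotopic
relative to the boundary to a map to some `M_β`. -/
theorem DirectedFamily.exists_deforms_cube {A : Type v} [Preorder A] [IsDirectedOrder A]
    {M : Type u} [TopologicalSpace M] {F : DirectedFamily A M} (hdense : Dense F.union)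
    (hcharts : AdmitsWellFilledCharts.{u, v, w} F) {ι : Type} [Fintype ι] {f : (ι → ℝ) → M}
    (hf : Continuous f) {α : A} (hlift : F.LiftsOn α (CubicalGrid.cubeBoundary ι) f) :
    ∃ β, α ≤ β ∧ ∃ H, F.Deforms f β (Icc 0 1) H ∧
      ∀ x ∈ CubicalGrid.cubeBoundary ι, ∀ t ∈ Icc (0 : ℝ) 1, H (x, t) = f x := by
  obtain ⟨N, hN⟩ := CubicalGrid.exists_deforms_skeleton hdense hcharts hf hlift
    (Fintype.card ι + 1) univ isOpen_univ fun _ => mem_univ _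
  obtain ⟨β, hβ, H, hH, hbd, -⟩ := hN N le_rfl
  rw [CubicalGrid.complex_cellsBelow_top] at hH
  exact ⟨β, hβ, H, hH, hbd⟩

/-! ### Homotopy groups -/

namespace DirectedFamily

variable {A : Type v} [Preorder A] {M : Type u} [TopologicalSpace M] {F : DirectedFamily A M}

theorem piIncl_piMap (k : ℕ) {p : M} {α β : F.Above p} (h : α ≤ β)
    (c : HomotopyGroup.Pi k (F.Space α.1) (F.pt α)) :
    F.piIncl k α c = F.piIncl k β (F.piMap k p α β h c) :=
  (homotopyGroupMap_comp (Fin k) (F.trans (α := α.1) (β := β.1) h) (F.incl β.1) (F.incl α.1)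
    rfl rfl rfl (fun _ => rfl) c).symm

/-- The projection of `ℝ^N` onto the unit cube. -/
noncomputable def cubeProj (N : Type) : C(N → ℝ, N → unitInterval) where
  toFun x i := projIcc 0 1 zero_le_one (x i)
  continuous_toFun := by fun_prop

theorem cubeProj_val {N : Type} (y : N → unitInterval) : cubeProj N (fun i => y i) = y :=
  funext fun i => projIcc_val zero_le_one (y i)

theorem val_mem_Icc {N : Type} (y : N → unitInterval) : (fun i => (y i : ℝ)) ∈ Icc (0 : N → ℝ) 1 :=
  ⟨fun i => (y i).2.1, fun i => (y i).2.2⟩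

theorem val_mem_cubeBoundary {N : Type} {y : N → unitInterval} (hy : y ∈ Cube.boundary N) :
    (fun i => (y i : ℝ)) ∈ CubicalGrid.cubeBoundary N := by
  obtain ⟨i, hi⟩ := hy
  refine ⟨val_mem_Icc y, i, ?_⟩
  rcases hi with hi | hi <;> simp [hi]

theorem projIcc_eq_of_eq {t : ℝ} (ht : t = 0 ∨ t = 1) :
    projIcc 0 1 zero_le_one t = (0 : unitInterval) ∨
      projIcc 0 1 zero_le_one t = (1 : unitInterval) := by
  rcases ht with rfl | rfl
  · exact Or.inl (projIcc_left _)
  · exact Or.inr (projIcc_right _)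

/-- The image of `1` under `λ_α` is idempotent, hence equal to `1`. -/
theorem InclusionsAreHoms.one_mem [Group M] [∀ α, Group (F.Space α)] (hF : F.InclusionsAreHoms)
    (α : A) : (1 : M) ∈ F.carrier α := by
  have h : F.incl α 1 = 1 := by
    have := hF α 1 1
    rw [mul_one] at this
    exact left_eq_mul.1 this
  exact h ▸ (1 : F.Space α).2

variable [IsDirectedOrder A]

/-- Every loop in `M` is homotopic to a loop in some `M_β`. -/
theorem exists_genLoop_homotopic (hdense : Dense F.union)
    (hcharts : AdmitsWellFilledCharts.{u, v, w} F) {N : Type} [Fintype N] {p : M} (α : F.Above p)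
    (γ : GenLoop N M p) :
    ∃ (β : F.Above p) (γ' : GenLoop N (F.Space β.1) (F.pt β)),
      GenLoop.Homotopic (genLoopMap N (F.incl β.1) rfl γ') γ := by
  have hbd : EqOn (γ ∘ cubeProj N) (fun _ => p) (CubicalGrid.cubeBoundary N) := by
    rintro x ⟨-, i, hi⟩
    exact γ.2 _ ⟨i, projIcc_eq_of_eq hi⟩
  obtain ⟨β, hαβ, H, hH, hHb⟩ := exists_deforms_cube hdense hcharts
    (f := γ ∘ cubeProj N) (γ.1.continuous.comp (cubeProj N).continuous) (α := α.1)
    ⟨fun _ => F.pt α, continuousOn_const, fun x hx => (hbd hx).symm⟩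
  obtain ⟨g, hg, hgH⟩ := hH.lifts
  have one_mem : (1 : ℝ) ∈ Icc (0 : ℝ) 1 := right_mem_Icc.2 zero_le_one
  refine ⟨⟨β, F.mono hαβ α.2⟩, ⟨⟨fun y => g fun i => y i, ?_⟩, fun y hy => ?_⟩, .symm ⟨⟨⟨⟨fun z =>
    H (fun i => z.2 i, z.1), ?_⟩, fun y => ?_, fun y => ?_⟩, fun t y hy => ?_⟩⟩⟩
  · exact hg.comp_continuous (by fun_prop) val_mem_Icc
  · refine F.incl_injective β ((hgH _ (val_mem_Icc y)).trans ?_)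
    have hy' := val_mem_cubeBoundary hy
    exact (hHb _ hy' 1 one_mem).trans (hbd hy')
  · exact hH.continuousOn.comp_continuous (by fun_prop) fun z => ⟨val_mem_Icc z.2, z.1.2⟩
  · refine (hH.zero _ (val_mem_Icc y)).trans ?_
    rw [Function.comp_apply, cubeProj_val]
    rfl
  · exact (hgH _ (val_mem_Icc y)).symm
  · refine (hHb _ (val_mem_cubeBoundary hy) t t.2).trans ?_
    rw [Function.comp_apply, cubeProj_val]
    rfl

/-- Loops in `M_α` which are homotopic in `M` are homotopic in some `M_β`. -/
theorem exists_homotopic_trans (hdense : Dense F.union)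
    (hcharts : AdmitsWellFilledCharts.{u, v, w} F) {N : Type} [Fintype N] {p : M} (α : F.Above p)
    {γ₀ γ₁ : GenLoop N (F.Space α.1) (F.pt α)}
    (h : GenLoop.Homotopic (genLoopMap N (F.incl α.1) (y := p) rfl γ₀)
      (genLoopMap N (F.incl α.1) rfl γ₁)) :
    ∃ (β : F.Above p) (hαβ : α ≤ β),
      GenLoop.Homotopic (x := F.pt β) (genLoopMap N (F.trans (α := α.1) (β := β.1) hαβ) rfl γ₀)
        (genLoopMap N (F.trans (α := α.1) (β := β.1) hαβ) rfl γ₁) := by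
  obtain ⟨G⟩ := h
  -- The homotopy becomes a map on a cube with the extra coordinate `none` for time.
  let q : (Option N → ℝ) → N → unitInterval := fun x => cubeProj N fun i => x (some i)
  have hq : Continuous q := by fun_prop
  let f : (Option N → ℝ) → M := fun x => G (projIcc 0 1 zero_le_one (x none), q x)
  have hf : Continuous f := by fun_prop
  let S : ℝ → Set (Option N → ℝ) := fun t => {x | x none = t}
  have hS : ∀ t, IsClosed (S t) := fun t => isClosed_eq (continuous_apply _) continuous_const
  let S' : Set (Option N → ℝ) := ⋃ i : N, ({x | x (some i) = 0} ∪ {x | x (some i) = 1})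
  have hS' : IsClosed S' := isClosed_iUnion_of_finite fun i =>
    (isClosed_eq (continuous_apply _) continuous_const).union
      (isClosed_eq (continuous_apply _) continuous_const)
  have e0 : ∀ x ∈ S 0, F.incl α.1 (γ₀ (q x)) = f x := by
    intro x hx
    have hx : x none = 0 := hx
    simp only [f, hx, projIcc_left]
    exact (G.map_zero_left (q x)).symm
  have e1 : ∀ x ∈ S 1, F.incl α.1 (γ₁ (q x)) = f x := by
    intro x hx
    have hx : x none = 1 := hx
    simp only [f, hx, projIcc_right]
    exact (G.map_one_left (q x)).symm
  have e2 : ∀ x ∈ S', F.incl α.1 (F.pt α) = f x := by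
    intro x hx
    obtain ⟨i, hi⟩ := mem_iUnion.1 hx
    have hb : q x ∈ Cube.boundary N := ⟨i, projIcc_eq_of_eq hi⟩
    refine Eq.symm ((G.eq_fst _ hb).trans ?_)
    exact (genLoopMap N (F.incl α.1) rfl γ₀).2 _ hb
  have l0 : F.LiftsOn α.1 (S 0) f := ⟨_, (γ₀.1.continuous.comp hq).continuousOn, e0⟩
  have l1 : F.LiftsOn α.1 (S 1) f := ⟨_, (γ₁.1.continuous.comp hq).continuousOn, e1⟩
  have l2 : F.LiftsOn α.1 S' f := ⟨_, continuousOn_const, e2⟩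
  -- The boundary of this cube consists of the two time ends and the sides: `f` is given there by
  -- `γ₀`, `γ₁` and the base point, all in `M_α`.
  have hl := (l0.union l1 (hS 0) (hS 1)).union l2 ((hS 0).union (hS 1)) hS'
  obtain ⟨β, hαβ, H, hH, hHb⟩ := exists_deforms_cube hdense hcharts hf (α := α.1) (hl.mono (by
    rintro x ⟨-, i | i, hi⟩
    · exact Or.inl hi
    · exact Or.inr (mem_iUnion.2 ⟨i, hi⟩)))
  obtain ⟨g, hg, hgH⟩ := hH.lifts
  let j : unitInterval × (N → unitInterval) → Option N → unitInterval := fun z i =>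
    i.elim z.1 z.2
  have hj : Continuous j := continuous_pi fun i => by
    cases i with
    | none => exact continuous_fst
    | some i => exact (continuous_apply i).comp continuous_snd
  have hqj : ∀ z, q (fun i => j z i) = z.2 := fun z => cubeProj_val z.2
  -- The deformation is relative to the boundary, so the lift `g` of its end map still joins `γ₀` to
  -- `γ₁` and keeps the sides at the base point.
  have key : ∀ z, j z ∈ Cube.boundary (Option N) → F.incl β (g fun i => j z i) = f fun i => j z i :=
    fun z hz => (hgH _ (val_mem_Icc _)).trans
      (hHb _ (val_mem_cubeBoundary hz) 1 (right_mem_Icc.2 zero_le_one))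
  refine ⟨⟨β, F.mono hαβ α.2⟩, hαβ, ⟨⟨⟨⟨fun z => g fun i => j z i, ?_⟩, fun y => ?_, fun y => ?_⟩,
    fun t y hy => ?_⟩⟩⟩
  · exact hg.comp_continuous (by fun_prop) fun z => val_mem_Icc _
  · refine F.incl_injective β ((key _ ⟨none, Or.inl rfl⟩).trans ?_)
    refine (e0 (fun i => j (0, y) i) (by simp [S, j])).symm.trans ?_
    rw [hqj]
    rfl
  · refine F.incl_injective β ((key _ ⟨none, Or.inr rfl⟩).trans ?_)
    refine (e1 (fun i => j (1, y) i) (by simp [S, j])).symm.trans ?_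
    rw [hqj]
    rfl
  · refine F.incl_injective β ?_
    have hb : (fun i => (j (t, y) i : ℝ)) ∈ S' := by
      obtain ⟨i, hi⟩ := hy
      refine mem_iUnion.2 ⟨i, ?_⟩
      rcases hi with hi | hi
      · exact Or.inl (by simp [j, hi])
      · exact Or.inr (by simp [j, hi])
    have hy' : j (t, y) ∈ Cube.boundary (Option N) := by
      obtain ⟨i, hi⟩ := hy
      exact ⟨some i, hi⟩
    refine (key _ hy').trans ((e2 _ hb).symm.trans ?_)
    exact congrArg (F.incl α.1) (γ₀.2 y hy).symm

theorem piIncl_surjective (hdense : Dense F.union)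
    (hcharts : AdmitsWellFilledCharts.{u, v, w} F) (k : ℕ) {p : M} (hp : p ∈ F.union)
    (c : HomotopyGroup.Pi k M p) : ∃ α c', F.piIncl k (p := p) α c' = c := by
  induction c using Quotient.inductionOn with
  | h γ =>
    obtain ⟨α, hα⟩ := mem_iUnion.1 hp
    obtain ⟨β, γ', h⟩ := exists_genLoop_homotopic hdense hcharts ⟨α, hα⟩ γ
    exact ⟨β, Quotient.mk _ γ', Quotient.sound h⟩

theorem exists_piMap_eq (hdense : Dense F.union)
    (hcharts : AdmitsWellFilledCharts.{u, v, w} F) (k : ℕ) {p : M} (α : F.Above p)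
    (c c' : HomotopyGroup.Pi k (F.Space α.1) (F.pt α)) (h : F.piIncl k α c = F.piIncl k α c') :
    ∃ (β : F.Above p) (hαβ : α ≤ β), F.piMap k p α β hαβ c = F.piMap k p α β hαβ c' := by
  induction c using Quotient.inductionOn with
  | h γ₀ =>
  induction c' using Quotient.inductionOn with
  | h γ₁ =>
    obtain ⟨β, hαβ, h⟩ := exists_homotopic_trans hdense hcharts α (Quotient.exact h)
    exact ⟨β, hαβ, Quotient.sound h⟩

end DirectedFamily

/-! ### Recognition of direct limits. -/

namespace DirectLimit

variable {ι : Type*} [Preorder ι] [IsDirectedOrder ι] {G : ι → Type*} {C : Type*}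
  {T : ∀ ⦃i j : ι⦄, i ≤ j → Type*} (f : ∀ i j (h : i ≤ j), T h)
  [∀ ⦃i j⦄ (h : i ≤ j), FunLike (T h) (G i) (G j)] [DirectedSystem G (f · · ·)]

/-- A recognition principle for direct limits of sets. -/
theorem exists_equiv (g : ∀ i, G i → C) (compat : ∀ i j h x, g i x = g j (f i j h x))
    (hsurj : ∀ c, ∃ i x, g i x = c)
    (hinj : ∀ i x y, g i x = g i y → ∃ j h, f i j h x = f i j h y) :
    ∃ ψ : DirectLimit G f ≃ C, ∀ i x, ψ (Quotient.mk _ ⟨i, x⟩) = g i x := by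
  refine ⟨Equiv.ofBijective (DirectLimit.lift f g compat) ⟨?_, fun c => ?_⟩, fun i x => rfl⟩
  · refine DirectLimit.induction₂ _ fun i x y h => ?_
    obtain ⟨j, hij, e⟩ := hinj i x y h
    exact Quotient.sound ⟨j, hij, hij, e⟩
  · obtain ⟨i, x, rfl⟩ := hsurj c
    exact ⟨Quotient.mk _ ⟨i, x⟩, rfl⟩

/-- A recognition principle for direct limits of magmas. -/
theorem exists_mulEquiv [∀ i, Mul (G i)] [∀ i j h, MulHomClass (T (i := i) (j := j) h) (G i) (G j)]
    [Mul C] (g : ∀ i, G i → C) (hg : ∀ i x y, g i (x * y) = g i x * g i y)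
    (compat : ∀ i j h x, g i x = g j (f i j h x)) (hsurj : ∀ c, ∃ i x, g i x = c)
    (hinj : ∀ i x y, g i x = g i y → ∃ j h, f i j h x = f i j h y) :
    ∃ ψ : DirectLimit G f ≃* C, ∀ i x, ψ (Quotient.mk _ ⟨i, x⟩) = g i x := by
  obtain ⟨ψ, hψ⟩ := exists_equiv f g compat hsurj hinj
  refine ⟨MulEquiv.mk' ψ (DirectLimit.induction₂ _ fun i x y => ?_), hψ⟩
  rw [mul_def, hψ, hψ, hψ, hg]

end DirectLimit

theorem mainTheorem2 {A : Type v} [Preorder A] [IsDirectedOrder A]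
    {M : Type u} [TopologicalSpace M] [T2Space M] (F : DirectedFamily A M)
    (hdense : Dense F.union) (hcharts : AdmitsWellFilledCharts.{u, v, w} F) :
    (∀ p ∈ F.union,
      (∀ k : ℕ,
        ∃ ψ : DirectLimit (fun α : F.Above p => HomotopyGroup.Pi k (F.Space α.1) (F.pt α))
            (F.piMap k p) ≃ HomotopyGroup.Pi k M p,
          ∀ (α : F.Above p) (c : HomotopyGroup.Pi k (F.Space α.1) (F.pt α)),
            ψ (Quotient.mk _ ⟨α, c⟩) = F.piIncl k α c) ∧
      (∀ k : ℕ,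
        ∃ ψ : DirectLimit (fun α : F.Above p => HomotopyGroup.Pi (k + 1) (F.Space α.1) (F.pt α))
            (F.piHom k p) ≃* HomotopyGroup.Pi (k + 1) M p,
          ∀ (α : F.Above p) (c : HomotopyGroup.Pi (k + 1) (F.Space α.1) (F.pt α)),
            ψ (Quotient.mk _ ⟨α, c⟩) = F.piIncl (k + 1) α c)) ∧
    (∀ [Group M] [IsTopologicalGroup M] [∀ α, Group (F.Space α)]
        [∀ α, IsTopologicalGroup (F.Space α)] (hF : F.InclusionsAreHoms),
      ∃ ψ : DirectLimit (fun α : F.Above (1 : M) => HomotopyGroup.Pi 0 (F.Space α.1) (F.pt α))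
          (hF.piZero 1) ≃* HomotopyGroup.Pi 0 M (1 : M),
        ∀ (α : F.Above (1 : M)) (c : HomotopyGroup.Pi 0 (F.Space α.1) (F.pt α)),
          ψ (Quotient.mk _ ⟨α, c⟩) = F.piIncl 0 α c) := by
  refine ⟨fun p hp => ⟨fun k => ?_, fun k => ?_⟩, fun {_ _ _ _} hF => ?_⟩
  · exact DirectLimit.exists_equiv (F.piMap k p) (fun α => F.piIncl k α)
      (fun _ _ h => F.piIncl_piMap k h) (F.piIncl_surjective hdense hcharts k hp)
      (F.exists_piMap_eq hdense hcharts k)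
  · exact DirectLimit.exists_mulEquiv (F.piHom k p) (fun α => F.piIncl (k + 1) α)
      (fun α => map_mul (homotopyGroupHom (Fin (k + 1)) (F.incl α.1) rfl))
      (fun _ _ h => F.piIncl_piMap (k + 1) h) (F.piIncl_surjective hdense hcharts (k + 1) hp)
      (F.exists_piMap_eq hdense hcharts (k + 1))
  -- As `M` contains `1`, density provides some index `α`, and every `M_α` contains `1`; so `1 ∈
  -- M_∞`.
  · obtain ⟨x, hx⟩ := hdense.nonempty
    obtain ⟨α, -⟩ := mem_iUnion.1 hx
    exact DirectLimit.exists_mulEquiv (hF.piZero 1) (fun α => F.piIncl 0 α)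
      (fun α => map_mul (piZeroHom (F.incl α.1) (hF α.1) rfl))
      (fun _ _ h => F.piIncl_piMap 0 h)
      (F.piIncl_surjective hdense hcharts 0 (mem_iUnion.2 ⟨α, hF.one_mem α⟩))
      (F.exists_piMap_eq hdense hcharts 0)
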